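/- Let $\mu$ be a measure on a measurable space $\mathcal X$, let $\Xi\subseteq\mathbb R$ and $\Theta\subseteq\mathbb R^d$, and for $\xi\in\Xi$, $\vartheta'\in\Theta$ let $p(\cdot\mid\xi,\vartheta')\ge 0$ be a probability density with respect to $\mu$. Let $P_{\xi,\vartheta'}$ be the distribution with this density and $P_{n,\xi,\vartheta'}$ the joint distribution of $n$ iid observations $X_1,\dots,X_n$ from it. Fix $\xi_0$ and a point $\vartheta$ in the interior of $\Theta$. Assume: (i) $\xi_0$ is an interior point of $\Xi$. (ii) For every $x$, $p(x\mid\xi,\vartheta')$ is twice continuously differentiable in $\xi\in\Xi$ for each $\vartheta'\in\Theta$, and once continuously differentiable in $\vartheta'\in\Theta$ for each $\xi\in\Xi$. (iii) Under $P_{\xi_0,\vartheta}$: $\mathbb P(\nabla_\xi p(X_1\mid\xi_0,\vartheta)=0)=1$ and $\mathbb P(\nabla_\xi^2 p(X_1\mid\xi_0,\vartheta)\neq 0)>0$. (iv) Under $P_{\xi_0,\vartheta}$: for every $a\in\mathbb R^d$, $\mathbb P(\nabla_\xi^2 p(X_1\mid\xi_0,\vartheta)\ne a^\top\nabla_\vartheta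 p(X_1\mid\xi_0,\vartheta))>0$. (v) (Modified differentiability in quadratic mean.) The vector $$v(x)=\begin{pmatrix}v_1(x)\\ v_2(x)\end{pmatrix}=\begin{pmatrix}\dfrac14\dfrac{\nabla_\xi^2p(x\mid\xi_0,\vartheta)}{\sqrt{p(x\mid\xi_0,\vartheta)}}\,\mathbb I_{[p(x\mid\xi_0,\vartheta)>0]}\\[2ex] \dfrac12\dfrac{\nabla_\vartheta p(x\mid\xi_0,\vartheta)}{\sqrt{p(x\mid\xi_0,\vartheta)}}\,\mathbb I_{[p(x\mid\xi_0,\vartheta)>0]}\end{pmatrix}\in\mathbb R^{1+d}$$ belongs to $L_2(\mu)$ and, with $h=((\xi-\xi_0)^2,(\vartheta'-\vartheta)^\top)^\top$, as $(\xi,\vartheta')\to(\xi_0,\vartheta)$ in $\Xi\times\Theta$, $$\int\Bigl|\sqrt{p(x\mid\xi,\vartheta')}-\sqrt{p(x\mid\xi_0,\vartheta)}-h^\top v(x)\Bigr|^2\mu(dx)=o(\|h\|^2);$$ moreover the total mass $\beta$ of the part of $P_{\xi,\vartheta'}$ that is singular with respect to $P_{\xi_0,\vartheta}$ satisfies $\beta=o(\|h\|^2)$.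 Put $$S_n=\begin{pmatrix}S_{1n}\\S_{2n}\end{pmatrix}=\frac{2}{\sqrt n}\sum_{i=1}^n\frac{v(X_i)}{\sqrt{p(X_i\mid\xi_0,\vartheta)}},\qquad J=4\int vv^\top\,d\mu .$$ Then for all fixed $\delta_1\in\mathbb R$ and $\delta_2\in\mathbb R^d$, with $t=(\delta_1^2,\delta_2^\top)^\top$, the log-likelihood ratio satisfies, under $P_{n,\xi_0,\vartheta}$, $$\Lambda_n=\log\frac{dP_{n,\xi_0+\delta_1n^{-1/4},\,\vartheta+\delta_2n^{-1/2}}}{dP_{n,\xi_0,\vartheta}}(X_1,\dots,X_n)=t^\top S_n-\tfrac12t^\top Jt+o_P(1)\qquad(n\to\infty),$$ where the derivative is that of the absolutely continuous part and $\log 0=-\infty$. Moreover, for every $n\ge1$, under $P_{n,\xi_0,\vartheta}$ the vector $S_n$ is square integrable and $$J=\begin{pmatrix}\mathbb E(S_{1n}^2)&\operatorname{cov}(S_{1n},S_{2n}^\top)\\ \operatorname{cov}(S_{2n},S_{1n})&\mathbb E(S_{2n}S_{2n}^\top)\end{pmatrix}.$$ -/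

import Mathlib

open MeasureTheory ProbabilityTheory Filter Topology Asymptotics Matrix

namespace ModifiedLAN

/-- The parametric family `p(x | ξ, ϑ)`, `ξ ∈ Ξ ⊆ ℝ`, `ϑ ∈ Θ ⊆ ℝ^d`, consists of probability
densities with respect to `μ`. -/
structure IsDensityFamily {X : Type*} [MeasurableSpace X] {d : ℕ} (μ : Measure X)
    (p : ℝ → EuclideanSpace ℝ (Fin d) → X → ℝ) (Ξ : Set ℝ)
    (Θ : Set (EuclideanSpace ℝ (Fin d))) : Prop where
  measurable : ∀ ξ ∈ Ξ, ∀ ϑ ∈ Θ, Measurable (p ξ ϑ)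
  nonneg : ∀ ξ ∈ Ξ, ∀ ϑ ∈ Θ, ∀ x, 0 ≤ p ξ ϑ x
  lintegral_eq_one : ∀ ξ ∈ Ξ, ∀ ϑ ∈ Θ, ∫⁻ x, ENNReal.ofReal (p ξ ϑ x) ∂μ = 1

/-- The distribution `P_{ξ,ϑ}` of one observation: the measure with `μ`-density `p(· | ξ, ϑ)`. -/
noncomputable def law {X : Type*} [MeasurableSpace X] {d : ℕ} (μ : Measure X)
    (p : ℝ → EuclideanSpace ℝ (Fin d) → X → ℝ) (ξ : ℝ) (ϑ : EuclideanSpace ℝ (Fin d)) :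
    Measure X :=
  μ.withDensity fun x => ENNReal.ofReal (p ξ ϑ x)

/-- The joint distribution `P_{n,ξ,ϑ}` of `n` iid observations. -/
noncomputable def jointLaw {X : Type*} [MeasurableSpace X] {d : ℕ} (μ : Measure X)
    (p : ℝ → EuclideanSpace ℝ (Fin d) → X → ℝ) (n : ℕ) (ξ : ℝ)
    (ϑ : EuclideanSpace ℝ (Fin d)) : Measure (Fin n → X) :=
  Measure.pi fun _ : Fin n => law μ p ξ ϑ

/-- `∇_ξ p(x | ξ, ϑ)`. -/
noncomputable def dξ {X : Type*} {d : ℕ} (p : ℝ → EuclideanSpace ℝ (Fin d) → X → ℝ)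
    (ξ : ℝ) (ϑ : EuclideanSpace ℝ (Fin d)) (x : X) : ℝ :=
  deriv (fun s => p s ϑ x) ξ

/-- `∇_ξ² p(x | ξ, ϑ)`. -/
noncomputable def ddξ {X : Type*} {d : ℕ} (p : ℝ → EuclideanSpace ℝ (Fin d) → X → ℝ)
    (ξ : ℝ) (ϑ : EuclideanSpace ℝ (Fin d)) (x : X) : ℝ :=
  iteratedDeriv 2 (fun s => p s ϑ x) ξ

/-- `∇_ϑ p(x | ξ, ϑ)`. -/
noncomputable def gradϑ {X : Type*} {d : ℕ} (p : ℝ → EuclideanSpace ℝ (Fin d) → X → ℝ)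
    (ξ : ℝ) (ϑ : EuclideanSpace ℝ (Fin d)) (x : X) : EuclideanSpace ℝ (Fin d) :=
  gradient (fun θ => p ξ θ x) ϑ

/-- Smoothness of the density, vanishing first-order score in `ξ`, and non-degeneracy of the
second-order score; probabilities are taken under the null distribution `P_{ξ₀,ϑ}`. -/
structure DensityAssumption {X : Type*} [MeasurableSpace X] {d : ℕ} (μ : Measure X)
    (p : ℝ → EuclideanSpace ℝ (Fin d) → X → ℝ) (Ξ : Set ℝ)
    (Θ : Set (EuclideanSpace ℝ (Fin d))) (ξ₀ : ℝ) (ϑ : EuclideanSpace ℝ (Fin d)) : Prop where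
  interior_mem : ξ₀ ∈ interior Ξ
  contDiffOn_ξ : ∀ θ ∈ Θ, ∀ x, ContDiffOn ℝ 2 (fun ξ => p ξ θ x) Ξ
  contDiffOn_ϑ : ∀ ξ ∈ Ξ, ∀ x, ContDiffOn ℝ 1 (fun θ => p ξ θ x) Θ
  first_score_zero : ∀ᵐ x ∂(law μ p ξ₀ ϑ), dξ p ξ₀ ϑ x = 0
  second_score_ne_zero : 0 < law μ p ξ₀ ϑ {x | ddξ p ξ₀ ϑ x ≠ 0}
  scores_not_collinear : ∀ a : EuclideanSpace ℝ (Fin d),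
    0 < law μ p ξ₀ ϑ {x | ddξ p ξ₀ ϑ x ≠ inner ℝ a (gradϑ p ξ₀ ϑ x)}

/-- The column vector `(a, bᵀ)ᵀ ∈ ℝ^{1+d}`, with Euclidean norm and inner product. -/
noncomputable def stack {d : ℕ} (a : ℝ) (b : EuclideanSpace ℝ (Fin d)) :
    EuclideanSpace ℝ (Unit ⊕ Fin d) :=
  WithLp.toLp 2 (Sum.elim (fun _ => a) b.ofLp)

/-- The increment `h = ((ξ - ξ₀)², (ϑ' - ϑ)ᵀ)ᵀ` attached to the parameter `q = (ξ, ϑ')`. -/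
noncomputable def increment {d : ℕ} (ξ₀ : ℝ) (ϑ : EuclideanSpace ℝ (Fin d))
    (q : ℝ × EuclideanSpace ℝ (Fin d)) : EuclideanSpace ℝ (Unit ⊕ Fin d) :=
  stack ((q.1 - ξ₀) ^ 2) (q.2 - ϑ)

/-- The modified differentiability in quadratic mean condition at `(ξ₀, ϑ)` with derivative `v`:
quadratic in the increment of `ξ`, linear in the increment of `ϑ`. The last field concerns the
mass `β(h)` of the part of `P_{ξ,ϑ'}` that is singular to `P_{ξ₀,ϑ}`. -/
structure ModifiedDQM {X : Type*} [MeasurableSpace X] {d : ℕ} (μ : Measure X)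
    (p : ℝ → EuclideanSpace ℝ (Fin d) → X → ℝ) (Ξ : Set ℝ)
    (Θ : Set (EuclideanSpace ℝ (Fin d))) (ξ₀ : ℝ) (ϑ : EuclideanSpace ℝ (Fin d))
    (v : X → EuclideanSpace ℝ (Unit ⊕ Fin d)) : Prop where
  memLp : MemLp v 2 μ
  expansion :
    (fun q : ℝ × EuclideanSpace ℝ (Fin d) =>
      ∫ x, |√(p q.1 q.2 x) - √(p ξ₀ ϑ x) - inner ℝ (increment ξ₀ ϑ q) (v x)| ^ 2 ∂μ)
      =o[𝓝[Ξ ×ˢ Θ] (ξ₀, ϑ)] fun q => ‖increment ξ₀ ϑ q‖ ^ 2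
  singular_mass :
    (fun q : ℝ × EuclideanSpace ℝ (Fin d) =>
      ((law μ p q.1 q.2).singularPart (law μ p ξ₀ ϑ)).real Set.univ)
      =o[𝓝[Ξ ×ˢ Θ] (ξ₀, ϑ)] fun q => ‖increment ξ₀ ϑ q‖ ^ 2

/-- The vector
`v = (¼ ∇_ξ² p / √p · 1[p > 0], ½ ∇_ϑ pᵀ / √p · 1[p > 0])ᵀ`, evaluated at `(ξ₀, ϑ)`. -/
noncomputable def scoreVec {X : Type*} {d : ℕ} (p : ℝ → EuclideanSpace ℝ (Fin d) → X → ℝ)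
    (ξ₀ : ℝ) (ϑ : EuclideanSpace ℝ (Fin d)) : X → EuclideanSpace ℝ (Unit ⊕ Fin d) :=
  {x | 0 < p ξ₀ ϑ x}.indicator fun x =>
    stack ((1 / 4) * (ddξ p ξ₀ ϑ x / √(p ξ₀ ϑ x)))
      ((1 / 2 : ℝ) • (√(p ξ₀ ϑ x))⁻¹ • gradϑ p ξ₀ ϑ x)

/-- `S_n = (2 / √n) ∑ᵢ v(xᵢ) / √p(xᵢ | ξ₀, ϑ)`. -/
noncomputable def scoreSum {X : Type*} {d : ℕ} (p : ℝ → EuclideanSpace ℝ (Fin d) → X → ℝ)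
    (ξ₀ : ℝ) (ϑ : EuclideanSpace ℝ (Fin d)) (n : ℕ) (x : Fin n → X) :
    EuclideanSpace ℝ (Unit ⊕ Fin d) :=
  (2 / √(n : ℝ)) • ∑ i, (√(p ξ₀ ϑ (x i)))⁻¹ • scoreVec p ξ₀ ϑ (x i)

/-- `J = 4 ∫ v vᵀ dμ`. -/
noncomputable def infoMatrix {X : Type*} [MeasurableSpace X] {d : ℕ} (μ : Measure X)
    (p : ℝ → EuclideanSpace ℝ (Fin d) → X → ℝ) (ξ₀ : ℝ) (ϑ : EuclideanSpace ℝ (Fin d)) :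
    Matrix (Unit ⊕ Fin d) (Unit ⊕ Fin d) ℝ :=
  Matrix.of fun i j => 4 * ∫ x, scoreVec p ξ₀ ϑ x i * scoreVec p ξ₀ ϑ x j ∂μ

/-- The log-likelihood ratio `Λ_n = log (dP_{n,ξ₀+δ₁n^{-1/4},ϑ+δ₂n^{-1/2}} / dP_{n,ξ₀,ϑ})`. The
derivative is that of the absolutely continuous part, and the value is an extended real
(`log 0 = -∞`). -/
noncomputable def logLR {X : Type*} [MeasurableSpace X] {d : ℕ} (μ : Measure X)
    (p : ℝ → EuclideanSpace ℝ (Fin d) → X → ℝ) (ξ₀ : ℝ) (ϑ : EuclideanSpace ℝ (Fin d))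
    (δ₁ : ℝ) (δ₂ : EuclideanSpace ℝ (Fin d)) (n : ℕ) (x : Fin n → X) : EReal :=
  ENNReal.log
    ((jointLaw μ p n (ξ₀ + δ₁ * (n : ℝ) ^ (-(1 / 4) : ℝ))
      (ϑ + ((n : ℝ) ^ (-(1 / 2) : ℝ)) • δ₂)).rnDeriv (jointLaw μ p n ξ₀ ϑ) x)

end ModifiedLAN

/-! This is Le Cam's argument through root densities. Let `f` be the null density, `q` the density
at the local parameter, `P` the null law and `W = 2(√q/√f - 1)`. On `{f > 0}`, which has full
`P`-measure, `q/f = (1 + W/2)²`, so the log-likelihood ratio is almost surely `∑ 2 log(1 +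
W(Xᵢ)/2)`, which behaves like `∑ W(Xᵢ) - ¼ ∑ W(Xᵢ)²`.

The rates `n^{-1/4}` and `n^{-1/2}` make the increment exactly `n^{-1/2} t`, so the quadratic mean
condition says that `√n W → g = 2⟨t, v⟩/√f` in `L²(P)`. Moreover `E W = -∫ (√q - √f)² dμ` exactly,
whence `n E W → -¼ E g²`. Consequently `E g = 0`, `∑ W(Xᵢ) = n^{-1/2} ∑ g(Xᵢ) - ¼ E g² + o_P(1)`, `∑
W(Xᵢ)² → E g²` and `max |W(Xᵢ)| → 0` in probability. The two quarters add up to the `½ tᵀJt`,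
because `E g² = tᵀJt`. The expansion is `tendsto_measure_log_prod_sub_ge`, its inputs are
`tendsto_integral_rootRatio`, and `logLR_ae_eq` links it to the Radon-Nikodym derivative.

The same identity `E g = 0`, for suitable `t`, centres the score, so the moment formula for `J`
holds exactly for each `n ≥ 1`. -/

namespace ModifiedLAN

/-! ### Convergence in probability along a sequence of experiments. -/

section ConvergenceInProbability

variable {Ω : ℕ → Type*} [∀ n, MeasurableSpace (Ω n)] {P : ∀ n, Measure (Ω n)}

/-- Convergence to zero in probability, for random variables on varying probability spaces. -/
def ConvInProbZero (P : ∀ n, Measure (Ω n)) (Y : ∀ n, Ω n → ℝ) : Prop :=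
  ∀ ε : ℝ, 0 < ε → Tendsto (fun n => P n {ω | ε ≤ |Y n ω|}) atTop (𝓝 0)

lemma ConvInProbZero.add {Y Z : ∀ n, Ω n → ℝ} (hY : ConvInProbZero P Y)
    (hZ : ConvInProbZero P Z) : ConvInProbZero P (fun n ω => Y n ω + Z n ω) := by
  intro ε hε
  have h := (hY (ε / 2) (by positivity)).add (hZ (ε / 2) (by positivity))
  rw [add_zero] at h
  refine tendsto_of_tendsto_of_tendsto_of_le_of_le tendsto_const_nhds h (fun _ => zero_le)
    fun n => (measure_mono ?_).trans (measure_union_le _ _)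
  intro ω hω
  simp only [Set.mem_ofPred_eq, Set.mem_union] at hω ⊢
  by_contra! hc
  have := abs_add_le (Y n ω) (Z n ω)
  linarith [hc.1, hc.2]

lemma ConvInProbZero.const_mul {Y : ∀ n, Ω n → ℝ} (hY : ConvInProbZero P Y) (c : ℝ) :
    ConvInProbZero P (fun n ω => c * Y n ω) := by
  intro ε hε
  -- The `+ 1` keeps the threshold meaningful when `c = 0`.
  refine tendsto_of_tendsto_of_tendsto_of_le_of_le tendsto_const_nhds
    (hY (ε / (|c| + 1)) (by positivity)) (fun _ => zero_le) fun n => measure_mono ?_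
  intro ω hω
  simp only [Set.mem_ofPred_eq] at hω ⊢
  rw [div_le_iff₀ (by positivity)]
  rw [abs_mul] at hω
  nlinarith [abs_nonneg (Y n ω)]

lemma ConvInProbZero.of_integral_abs [∀ n, IsProbabilityMeasure (P n)] {Y : ∀ n, Ω n → ℝ}
    (hi : ∀ᶠ n in atTop, Integrable (Y n) (P n))
    (h : Tendsto (fun n => ∫ ω, |Y n ω| ∂(P n)) atTop (𝓝 0)) : ConvInProbZero P Y := by
  intro ε hε
  have h' : Tendsto (fun n => ENNReal.ofReal ((∫ ω, |Y n ω| ∂(P n)) / ε)) atTop (𝓝 0) := by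
    simpa using ENNReal.tendsto_ofReal (h.div_const ε)
  refine tendsto_of_tendsto_of_tendsto_of_le_of_le' tendsto_const_nhds h'
    (Eventually.of_forall fun _ => zero_le) ?_
  filter_upwards [hi] with n hn
  rw [← ofReal_measureReal]
  refine ENNReal.ofReal_le_ofReal ?_
  rw [le_div_iff₀ hε, mul_comm]
  exact mul_meas_ge_le_integral_of_nonneg (Eventually.of_forall fun _ => abs_nonneg _) hn.abs ε

lemma ConvInProbZero.of_variance [∀ n, IsProbabilityMeasure (P n)] {Y : ∀ n, Ω n → ℝ}
    (hi : ∀ᶠ n in atTop, MemLp (Y n) 2 (P n))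
    (h : Tendsto (fun n => Var[Y n; P n]) atTop (𝓝 0)) :
    ConvInProbZero P (fun n ω => Y n ω - ∫ ω, Y n ω ∂(P n)) := by
  intro ε hε
  have h' : Tendsto (fun n => ENNReal.ofReal (Var[Y n; P n] / ε ^ 2)) atTop (𝓝 0) := by
    simpa using ENNReal.tendsto_ofReal (h.div_const (ε ^ 2))
  refine tendsto_of_tendsto_of_tendsto_of_le_of_le' tendsto_const_nhds h'
    (Eventually.of_forall fun _ => zero_le) ?_
  filter_upwards [hi] with n hn
  exact meas_ge_le_variance_div_sq hn hε

lemma ConvInProbZero.of_const [∀ n, IsProbabilityMeasure (P n)] {c : ℕ → ℝ}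
    (h : Tendsto c atTop (𝓝 0)) : ConvInProbZero P (fun n _ => c n) := by
  refine ConvInProbZero.of_integral_abs (Eventually.of_forall fun n => integrable_const _) ?_
  simpa using h.abs

end ConvergenceInProbability

/-! ### From `L²` convergence to `L¹` convergence of squares. -/

section SquareConvergence

variable {X : Type*} [MeasurableSpace X] {μ : Measure X}

/-- Convergence in `L²` implies convergence of the squares in `L¹`. -/
lemma tendsto_integral_abs_sq_sub_sq {a : ℕ → X → ℝ} {b : X → ℝ}
    (ha : ∀ᶠ n in atTop, MemLp (a n) 2 μ) (hb : MemLp b 2 μ)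
    (h : Tendsto (fun n => ∫ x, (a n x - b x) ^ 2 ∂μ) atTop (𝓝 0)) :
    Tendsto (fun n => ∫ x, |a n x ^ 2 - b x ^ 2| ∂μ) atTop (𝓝 0) := by
  set K := ∫ x, b x ^ 2 ∂μ
  have hK : 0 ≤ K := integral_nonneg fun _ => sq_nonneg _
  -- Weighted Young inequality: with `r = a - b`, `a² - b² = r² + 2rb` and `2|rb| ≤ r²/η + ηb²`.
  -- Later `η` is taken so small that `ηK ≤ ε/2`.
  have key : ∀ η : ℝ, 0 < η → ∀ᶠ n in atTop, ∫ x, |a n x ^ 2 - b x ^ 2| ∂μ ≤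
      (1 + 1 / η) * ∫ x, (a n x - b x) ^ 2 ∂μ + η * K := by
    intro η hη
    filter_upwards [ha] with n hn
    have i1 : Integrable (fun x => (a n x - b x) ^ 2) μ := (hn.sub hb).integrable_sq
    have i2 : Integrable (fun x => b x ^ 2) μ := hb.integrable_sq
    rw [← integral_const_mul, ← integral_const_mul, ← integral_add (i1.const_mul _) (i2.const_mul _)]
    refine integral_mono (hn.integrable_sq.sub i2).abs ((i1.const_mul _).add (i2.const_mul _)) ?_
    intro x
    simp only
    set r := a n x - b x with hr
    have e : a n x ^ 2 - b x ^ 2 = r ^ 2 + 2 * r * b x := by rw [hr]; ring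
    have q : 1 / η * r ^ 2 + η * b x ^ 2 - |2 * r * b x| ≥ 0 := by
      have : 1 / η * r ^ 2 + η * b x ^ 2 - |2 * r * b x| = (|r| - η * |b x|) ^ 2 / η := by
        rw [abs_mul, abs_mul, ← sq_abs r, ← sq_abs (b x)]
        field_simp
        rw [abs_of_pos (by norm_num : (0 : ℝ) < 2)]
        ring
      rw [this]; positivity
    rw [e]
    calc _ ≤ |r ^ 2| + |2 * r * b x| := abs_add_le _ _
      _ ≤ _ := by rw [abs_of_nonneg (sq_nonneg r)]; linarith
  rw [Metric.tendsto_nhds]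
  intro ε hε
  have hη : 0 < ε / (2 * (K + 1)) := by positivity
  have h2 := h.const_mul (1 + 1 / (ε / (2 * (K + 1))))
  rw [mul_zero] at h2
  filter_upwards [key _ hη, h2.eventually_lt_const (half_pos hε)] with n h3 h4
  have : ε / (2 * (K + 1)) * K ≤ ε / 2 := by
    rw [div_mul_eq_mul_div, div_le_div_iff₀ (by positivity) (by positivity)]
    nlinarith
  rw [Real.dist_0_eq_abs, abs_of_nonneg (integral_nonneg fun _ => abs_nonneg _)]
  linarith

end SquareConvergence

/-! ### Sums of iid variables on finite product spaces. -/

section Product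

variable {X : Type*} [MeasurableSpace X] (P : Measure X) [IsProbabilityMeasure P]

/-- The weak law of large numbers on finite product spaces. -/
lemma convInProbZero_average {f : X → ℝ} (hf : Integrable f P) :
    ConvInProbZero (fun n => Measure.pi fun _ : Fin n => P)
      (fun n x => (n : ℝ)⁻¹ * ∑ i, f (x i) - ∫ x, f x ∂P) := by
  -- All samples are embedded in one infinite iid sequence, where the `L¹` form of the strong law
  -- applies; `hres` carries its `L¹` norms back to the finite products.
  let Q : Measure (ℕ → X) := Measure.infinitePi fun _ => P
  have hev (i : ℕ) : MeasurePreserving (fun ω : ℕ → X => ω i) Q P :=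
    measurePreserving_eval_infinitePi (fun _ => P) i
  have hres (n : ℕ) : MeasurePreserving (fun (ω : ℕ → X) (i : Fin n) => ω i) Q
      (Measure.pi fun _ : Fin n => P) := by
    refine ⟨by fun_prop, ?_⟩
    rw [← Measure.infinitePi_eq_pi]
    exact Measure.map_infinitePi_infinitePi_of_inj (P := fun _ : ℕ => P) Fin.val_injective
  have hfm (i : ℕ) : AEMeasurable f (Q.map fun ω => ω i) := by
    rw [(hev i).map_eq]; exact hf.aemeasurable
  have h := strong_law_Lp (μ := Q) le_rfl ENNReal.one_ne_top (fun i ω => f (ω i))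
    (memLp_one_iff_integrable.2 ((hev 0).integrable_comp_of_integrable hf))
    (fun i j hij => ((iIndepFun_infinitePi (P := fun _ : ℕ => P) (X := fun _ x => x)
      (fun _ => measurable_id)).indepFun hij).comp₀ (hev i).aemeasurable (hev j).aemeasurable
      (hfm i) (hfm j))
    (fun i => (IdentDistrib.mk (hev i).aemeasurable (hev 0).aemeasurable
      ((hev i).map_eq.trans (hev 0).map_eq.symm)).comp_of_aemeasurable (hfm i))
  have hint (n : ℕ) : Integrable (fun x : Fin n → X => (n : ℝ)⁻¹ * ∑ i, f (x i) - ∫ x, f x ∂P)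
      (Measure.pi fun _ : Fin n => P) :=
    ((integrable_finsetSum _ fun i _ => integrable_comp_eval (μ := fun _ : Fin n => P) hf).const_mul _).sub (integrable_const _)
  refine ConvInProbZero.of_integral_abs (Eventually.of_forall hint) ?_
  have h' := (ENNReal.tendsto_toReal ENNReal.zero_ne_top).comp h
  refine h'.congr fun n => ?_
  have e1 : (fun ω : ℕ → X => (n : ℝ)⁻¹ • ∑ i ∈ Finset.range n, f (ω i) - ∫ ω, f (ω 0) ∂Q) =
      (fun x : Fin n → X => (n : ℝ)⁻¹ * ∑ i, f (x i) - ∫ x, f x ∂P) ∘ fun ω i => ω i := by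
    ext ω
    simp only [Function.comp_apply, smul_eq_mul]
    rw [Finset.sum_range, ← (hev 0).map_eq, integral_map (hev 0).aemeasurable]
    rw [(hev 0).map_eq]; exact hf.aestronglyMeasurable
  simp only [Function.comp_apply]
  rw [e1, eLpNorm_comp_measurePreserving (hint n).aestronglyMeasurable (hres n),
    eLpNorm_one_eq_lintegral_enorm, ← integral_norm_eq_lintegral_enorm (hint n).aestronglyMeasurable]
  simp only [Real.norm_eq_abs]

variable {P}

lemma memLp_sum_pi {E : Type*} [NormedAddCommGroup E] {f : X → E} (hf : MemLp f 2 P) (n : ℕ) :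
    MemLp (fun x : Fin n → X => ∑ i, f (x i)) 2 (Measure.pi fun _ : Fin n => P) :=
  memLp_finsetSum _ fun i _ => hf.comp_measurePreserving (measurePreserving_eval _ i)

lemma integral_sum_pi {f : X → ℝ} (hf : Integrable f P) (n : ℕ) :
    ∫ x : Fin n → X, ∑ i, f (x i) ∂(Measure.pi fun _ : Fin n => P) = n * ∫ x, f x ∂P := by
  rw [integral_finsetSum _ fun i _ => integrable_comp_eval (μ := fun _ : Fin n => P) hf]
  simp_rw [integral_comp_eval (μ := fun _ : Fin n => P) hf.aestronglyMeasurable]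
  simp

lemma sq_integral_le_integral_sq {f : X → ℝ} (hf : MemLp f 2 P) :
    (∫ x, f x ∂P) ^ 2 ≤ ∫ x, f x ^ 2 ∂P := by
  have := variance_nonneg f P
  rw [variance_eq_sub hf] at this
  simpa using this

end Product

/-! ### The expansion for `√n W_n → g` in quadratic mean. -/

section QuadraticMean

variable {X : Type*} [MeasurableSpace X] {P : Measure X} [IsProbabilityMeasure P]
  {W : ℕ → X → ℝ} {g : X → ℝ}

/-- If `√n W_n → g` in `L²(P)` and `n E W_n` converges, then `E g = 0`. -/
lemma integral_eq_zero_of_tendsto {c : ℝ}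
    (hW : ∀ᶠ n in atTop, MemLp (W n) 2 P) (hg : MemLp g 2 P)
    (hR : Tendsto (fun n : ℕ => ∫ x, (√n * W n x - g x) ^ 2 ∂P) atTop (𝓝 0))
    (hmean : Tendsto (fun n : ℕ => n * ∫ x, W n x ∂P) atTop (𝓝 c)) :
    ∫ x, g x ∂P = 0 := by
  -- Jensen gives `√n E W_n → E g`, while `√n E W_n = n^{-1/2} (n E W_n) → 0`.
  have h1 : Tendsto (fun n : ℕ => (√n * ∫ x, W n x ∂P - ∫ x, g x ∂P) ^ 2) atTop (𝓝 0) := by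
    refine squeeze_zero' (Eventually.of_forall fun _ => sq_nonneg _) ?_ hR
    filter_upwards [hW] with n hn
    have := sq_integral_le_integral_sq ((hn.const_mul (√n)).sub hg)
    simp only [Pi.sub_apply] at this
    rwa [integral_sub ((hn.integrable one_le_two).const_mul _) (hg.integrable one_le_two),
      integral_const_mul] at this
  have hs : Tendsto (fun n : ℕ => (√(n : ℝ))⁻¹) atTop (𝓝 0) :=
    (Real.tendsto_sqrt_atTop.comp tendsto_natCast_atTop_atTop).inv_tendsto_atTop
  have h2 : Tendsto (fun n : ℕ => √n * ∫ x, W n x ∂P) atTop (𝓝 0) := by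
    have := hs.mul hmean
    rw [zero_mul] at this
    refine this.congr' ?_
    filter_upwards [eventually_gt_atTop 0] with n hn
    have hn' : (0 : ℝ) < n := by exact_mod_cast hn
    have : (n : ℝ) = √n * √n := (Real.mul_self_sqrt hn'.le).symm
    have h0 : √(n : ℝ) ≠ 0 := (Real.sqrt_pos.2 hn').ne'
    rw [← mul_assoc]
    congr 1
    nth_rw 2 [this]
    field_simp
  have h3 := (h2.sub_const (∫ x, g x ∂P)).pow 2
  have h4 := tendsto_nhds_unique h3 h1
  simpa using h4

/-- The sum of the `W_n(X_i)` is asymptotically linear in the score `g`. -/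
lemma convInProbZero_linear_part {c : ℝ}
    (hW : ∀ᶠ n in atTop, MemLp (W n) 2 P) (hg : MemLp g 2 P)
    (hR : Tendsto (fun n : ℕ => ∫ x, (√n * W n x - g x) ^ 2 ∂P) atTop (𝓝 0))
    (hmean : Tendsto (fun n : ℕ => n * ∫ x, W n x ∂P) atTop (𝓝 c)) :
    ConvInProbZero (fun n => Measure.pi fun _ : Fin n => P)
      (fun n x => ∑ i, W n (x i) - (√n)⁻¹ * ∑ i, g (x i) - c) := by
  have hg0 := integral_eq_zero_of_tendsto hW hg hR hmean
  -- The sum of the remainders has variance `n Var R_n ≤ E(√n W_n - g)² → 0`, so only its mean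
  -- survives; as `E g = 0`, that mean is `n E W_n → c`.
  let R : ℕ → X → ℝ := fun n x => W n x - (√n)⁻¹ * g x
  have hRm : ∀ᶠ n in atTop, MemLp (R n) 2 P := by
    filter_upwards [hW] with n hn using hn.sub (hg.const_mul _)
  have hvar : Tendsto (fun n => Var[fun x : Fin n → X => ∑ i, R n (x i);
      Measure.pi fun _ : Fin n => P]) atTop (𝓝 0) := by
    refine squeeze_zero' (Eventually.of_forall fun _ => variance_nonneg _ _) ?_ hR
    filter_upwards [hRm, eventually_gt_atTop 0] with n hn hn0
    have hn' : (0 : ℝ) < n := by exact_mod_cast hn0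
    have h0 : √(n : ℝ) ≠ 0 := (Real.sqrt_pos.2 hn').ne'
    have e : (fun x : Fin n → X => ∑ i, R n (x i)) = ∑ i, fun x => R n (x i) := by
      ext x; simp
    rw [e, variance_sum_pi (μ := fun _ : Fin n => P) (X := fun _ => R n) fun _ => hn]
    simp only [Finset.sum_const, Finset.card_univ, Fintype.card_fin, nsmul_eq_mul]
    calc (n : ℝ) * Var[R n; P] ≤ n * ∫ x, R n x ^ 2 ∂P := by
          gcongr
          simpa using variance_le_expectation_sq hn.aestronglyMeasurable
      _ = ∫ x, (√n * W n x - g x) ^ 2 ∂P := by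
          rw [← integral_const_mul]
          congr with x
          have : (n : ℝ) = √n ^ 2 := (Real.sq_sqrt hn'.le).symm
          nth_rw 1 [this]
          rw [← mul_pow]
          simp only [R]
          congr 1
          field_simp
  have h1 := ConvInProbZero.of_variance (hRm.mono fun n hn => memLp_sum_pi hn n) hvar
  have h2 := h1.add (ConvInProbZero.of_const (P := fun n => Measure.pi fun _ : Fin n => P)
    (by simpa using hmean.sub_const c : Tendsto (fun n : ℕ => n * ∫ x, W n x ∂P - c) atTop (𝓝 0)))
  intro ε hε
  refine (h2 ε hε).congr' ?_
  filter_upwards [hRm, hW] with n hn hWn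
  have hi : ∫ x, R n x ∂P = ∫ x, W n x ∂P := by
    simp only [R]
    rw [integral_sub (hWn.integrable one_le_two) ((hg.integrable one_le_two).const_mul _),
      integral_const_mul, hg0, mul_zero, sub_zero]
  rw [integral_sum_pi (hn.integrable one_le_two), hi]
  congr with x
  simp only [R, Finset.sum_sub_distrib, Finset.mul_sum]
  congr! 2
  ring

/-- The sum of squares of the `W_n(X_i)` converges in probability to `E g²`. -/
lemma convInProbZero_sum_sq
    (hW : ∀ᶠ n in atTop, MemLp (W n) 2 P) (hg : MemLp g 2 P)
    (hR : Tendsto (fun n : ℕ => ∫ x, (√n * W n x - g x) ^ 2 ∂P) atTop (𝓝 0)) :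
    ConvInProbZero (fun n => Measure.pi fun _ : Fin n => P)
      (fun n x => ∑ i, W n (x i) ^ 2 - ∫ x, g x ^ 2 ∂P) := by
  have hW' : ∀ᶠ n : ℕ in atTop, MemLp (fun x => √n * W n x) 2 P := by
    filter_upwards [hW] with n hn using hn.const_mul _
  have h1 := tendsto_integral_abs_sq_sub_sq hW' hg hR
  have hint : ∀ᶠ n : ℕ in atTop, Integrable (fun x => W n x ^ 2 - (n : ℝ)⁻¹ * g x ^ 2) P := by
    filter_upwards [hW] with n hn using hn.integrable_sq.sub (hg.integrable_sq.const_mul _)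
  -- The `L¹` norm of this sum is at most `E|(√n W_n)² - g²|`, so `W_n²` may be replaced by `g²/n`,
  -- to which the weak law applies.
  have h2 : ConvInProbZero (fun n => Measure.pi fun _ : Fin n => P)
      (fun n x => ∑ i, (W n (x i) ^ 2 - (n : ℝ)⁻¹ * g (x i) ^ 2)) := by
    refine ConvInProbZero.of_integral_abs ?_ ?_
    · filter_upwards [hint] with n hn
      exact integrable_finsetSum _ fun i _ =>
        integrable_comp_eval (μ := fun _ : Fin n => P) (i := i) hn
    · refine squeeze_zero' (Eventually.of_forall fun _ => integral_nonneg fun _ => abs_nonneg _)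
        ?_ h1
      filter_upwards [hint, eventually_gt_atTop 0] with n hn hn0
      have hn' : (0 : ℝ) < n := by exact_mod_cast hn0
      have hi (i : Fin n) := integrable_comp_eval (μ := fun _ : Fin n => P) (i := i) hn
      calc _ ≤ ∫ x : Fin n → X, ∑ i, |W n (x i) ^ 2 - (n : ℝ)⁻¹ * g (x i) ^ 2|
              ∂(Measure.pi fun _ : Fin n => P) :=
            integral_mono (integrable_finsetSum _ fun i _ => hi i).abs
              (integrable_finsetSum _ fun i _ => (hi i).abs)
              fun x => Finset.abs_sum_le_sum_abs _ _
        _ = n * ∫ x, |W n x ^ 2 - (n : ℝ)⁻¹ * g x ^ 2| ∂P := integral_sum_pi hn.abs n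
        _ = ∫ x, |(√n * W n x) ^ 2 - g x ^ 2| ∂P := by
            rw [← integral_const_mul]
            congr with x
            nth_rw 1 [← abs_of_pos hn']
            rw [← abs_mul, mul_pow, Real.sq_sqrt hn'.le, mul_sub, mul_inv_cancel_left₀ hn'.ne']
        _ ≤ _ := le_rfl
  have h3 := h2.add (convInProbZero_average P hg.integrable_sq)
  intro ε hε
  refine (h3 ε hε).congr fun n => ?_
  congr with x
  simp only [Finset.sum_sub_distrib, ← Finset.mul_sum]
  congr! 2
  ring

/-- The maximum of the `|W_n(X_i)|` converges to zero in probability. -/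
lemma tendsto_measure_exists_le_abs
    (hW : ∀ᶠ n in atTop, MemLp (W n) 2 P) (hg : MemLp g 2 P)
    (hR : Tendsto (fun n : ℕ => ∫ x, (√n * W n x - g x) ^ 2 ∂P) atTop (𝓝 0))
    {η : ℝ} (hη : 0 < η) :
    Tendsto (fun n => (Measure.pi fun _ : Fin n => P) {x | ∃ i, η ≤ |W n (x i)|}) atTop (𝓝 0) := by
  have hnull (n : ℕ) : NullMeasurableSet {x | η * √n / 2 ≤ |g x|} P :=
    nullMeasurableSet_le aemeasurable_const hg.aestronglyMeasurable.aemeasurable.abs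
  have htail : Tendsto (fun n : ℕ => ∫ x, {x | η * √n / 2 ≤ |g x|}.indicator (fun x => g x ^ 2) x ∂P)
      atTop (𝓝 0) := by
    have : Tendsto (fun n : ℕ =>
        ∫ x, {x | η * √n / 2 ≤ |g x|}.indicator (fun x => g x ^ 2) x ∂P)
        atTop (𝓝 (∫ _, 0 ∂P)) := by
      refine tendsto_integral_of_dominated_convergence (fun x => g x ^ 2)
        (fun n => hg.integrable_sq.aestronglyMeasurable.indicator₀ (hnull n)) hg.integrable_sq
        (fun n => Eventually.of_forall fun x => ?_) (Eventually.of_forall fun x => ?_)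
      · rw [Real.norm_eq_abs, abs_of_nonneg (Set.indicator_nonneg (fun _ _ => sq_nonneg _) _)]
        exact Set.indicator_le_self' (fun _ _ => sq_nonneg _) _
      · have hs : Tendsto (fun n : ℕ => η * √n / 2) atTop atTop :=
          ((Real.tendsto_sqrt_atTop.comp tendsto_natCast_atTop_atTop).const_mul_atTop
            hη).atTop_div_const two_pos
        refine tendsto_const_nhds.congr' ?_
        filter_upwards [hs.eventually_gt_atTop |g x|] with n hn
        rw [Set.indicator_of_notMem]
        simpa using hn
    simpa using this
  -- The constant is `n / (η√n/2)²`, from the union bound over `n` coordinates and Markov's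
  -- inequality.
  have hsum := (htail.add hR).const_mul (4 / η ^ 2)
  rw [add_zero, mul_zero] at hsum
  have hsum' := ENNReal.tendsto_ofReal hsum
  rw [ENNReal.ofReal_zero] at hsum'
  refine tendsto_of_tendsto_of_tendsto_of_le_of_le' tendsto_const_nhds hsum'
    (Eventually.of_forall fun _ => zero_le) ?_
  filter_upwards [hW, eventually_gt_atTop 0] with n hn hn0
  have hn' : (0 : ℝ) < n := by exact_mod_cast hn0
  have hsn : 0 < √(n : ℝ) := Real.sqrt_pos.2 hn'
  set A := {x | η ≤ |W n x|} with hA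
  have hAnull : NullMeasurableSet A P :=
    nullMeasurableSet_le aemeasurable_const hn.aestronglyMeasurable.aemeasurable.abs
  set B := fun x => {x | η * √n / 2 ≤ |g x|}.indicator (fun x => g x ^ 2) x + (√n * W n x - g x) ^ 2
  have iB1 : Integrable ({x | η * √n / 2 ≤ |g x|}.indicator (fun x => g x ^ 2)) P :=
    hg.integrable_sq.indicator₀ (hnull n)
  have iB2 : Integrable (fun x => (√n * W n x - g x) ^ 2) P :=
    ((hn.const_mul _).sub hg).integrable_sq
  -- If `|√n W_n| ≥ η√n`, then `|g|` or `|√n W_n - g|` is at least half of that.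
  have hsub : A ⊆ {x | (η * √n / 2) ^ 2 ≤ B x} := by
    intro x hx
    simp only [hA, Set.mem_ofPred_eq, B] at hx ⊢
    by_cases h : η * √n / 2 ≤ |g x|
    · rw [Set.indicator_of_mem (by simpa using h)]
      have := pow_le_pow_left₀ (by positivity) h 2
      rw [sq_abs] at this
      nlinarith [sq_nonneg (√n * W n x - g x)]
    · rw [Set.indicator_of_notMem (by simpa using h), zero_add, ← sq_abs (√n * W n x - g x)]
      refine pow_le_pow_left₀ (by positivity) ?_ 2
      have h1 := abs_sub_abs_le_abs_sub (√n * W n x) (g x)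
      rw [abs_mul, abs_of_pos hsn] at h1
      nlinarith
  have hBnn : ∀ x, 0 ≤ B x := fun x =>
    add_nonneg (Set.indicator_nonneg (fun _ _ => sq_nonneg _) _) (sq_nonneg _)
  have hmk : (η * √n / 2) ^ 2 * P.real A ≤ ∫ x, B x ∂P :=
    (mul_le_mul_of_nonneg_left (measureReal_mono hsub) (sq_nonneg _)).trans
      (mul_meas_ge_le_integral_of_nonneg (Eventually.of_forall hBnn) (iB1.add iB2) _)
  have hset : {x : Fin n → X | ∃ i, η ≤ |W n (x i)|} = ⋃ i, (fun x => x i) ⁻¹' A := by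
    ext x; simp [hA]
  calc _ ≤ ∑ i : Fin n, (Measure.pi fun _ : Fin n => P) ((fun x => x i) ⁻¹' A) := by
        rw [hset]; exact measure_iUnion_fintype_le _ _
    _ = n * P A := by
        simp_rw [fun i : Fin n => (measurePreserving_eval (fun _ : Fin n => P)
          i).measure_preimage hAnull]
        simp
    _ = ENNReal.ofReal (n * P.real A) := by
        rw [ENNReal.ofReal_mul hn'.le, ofReal_measureReal, ENNReal.ofReal_natCast]
    _ ≤ _ := by
        refine ENNReal.ofReal_le_ofReal ?_
        rw [← integral_add iB1 iB2, div_mul_eq_mul_div, le_div_iff₀ (by positivity)]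
        rw [div_pow, mul_pow, Real.sq_sqrt hn'.le] at hmk
        change _ ≤ 4 * ∫ x, B x ∂P
        linarith

/-- Second-order Taylor expansion of the logarithm with cubic remainder. One factor `|w| < η` is
taken out of the remainder, so that after summation it is controlled by `η ∑ W²`. -/
lemma abs_two_mul_log_sub_le {w η : ℝ} (hη : η ≤ 1) (hw : |w| < η) :
    |2 * Real.log (1 + w / 2) - w + w ^ 2 / 4| ≤ η / 2 * w ^ 2 := by
  have h0 := abs_nonneg w
  have hx : |-w / 2| = |w| / 2 := by rw [abs_div, abs_neg, abs_two]
  have h := Real.abs_log_sub_add_sum_range_le (x := -w / 2) (by rw [hx]; linarith) 2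
  rw [hx] at h
  simp only [Finset.sum_range_succ, Finset.sum_range_zero] at h
  have e : 2 * Real.log (1 + w / 2) - w + w ^ 2 / 4 =
      2 * (0 + (-w / 2) ^ (0 + 1) / ((0 : ℕ) + 1) + (-w / 2) ^ (1 + 1) / ((1 : ℕ) + 1) +
        Real.log (1 - -w / 2)) := by
    push_cast
    rw [show 1 - -w / 2 = 1 + w / 2 by ring]
    ring
  rw [e, abs_mul, abs_two]
  have h2 : (|w| / 2) ^ (2 + 1) / (1 - |w| / 2) ≤ η / 4 * w ^ 2 := by
    rw [div_le_iff₀ (by linarith), ← sq_abs w]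
    have : 0 ≤ |w| ^ 2 * (η / 4 * (1 - |w| / 2) - |w| / 8) := by
      refine mul_nonneg (sq_nonneg _) ?_
      nlinarith
    nlinarith
  linarith

/-- A local asymptotic normality expansion for products: if `√n W_n → g` in `L²(P)` and
`n E W_n → -¼ E g²`, then `∑ᵢ log (1 + W_n(X_i)/2)² = n^{-1/2} ∑ᵢ g(X_i) - ½ E g² + o_P(1)`. -/
theorem tendsto_measure_log_prod_sub_ge
    (hW : ∀ᶠ n in atTop, MemLp (W n) 2 P) (hg : MemLp g 2 P)
    (hR : Tendsto (fun n : ℕ => ∫ x, (√n * W n x - g x) ^ 2 ∂P) atTop (𝓝 0))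
    (hmean : Tendsto (fun n : ℕ => n * ∫ x, W n x ∂P) atTop (𝓝 (-(∫ x, g x ^ 2 ∂P) / 4)))
    {ε : ℝ} (hε : 0 < ε) :
    Tendsto (fun n : ℕ => (Measure.pi fun _ : Fin n => P)
      {x | ENNReal.ofReal ε ≤ (ENNReal.log (∏ i, ENNReal.ofReal ((1 + W n (x i) / 2) ^ 2)) -
        (((√n)⁻¹ * ∑ i, g (x i) - 1 / 2 * ∫ x, g x ^ 2 ∂P : ℝ) : EReal)).abs})
      atTop (𝓝 0) := by
  set σ := ∫ x, g x ^ 2 ∂P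
  have hσ : 0 ≤ σ := integral_nonneg fun _ => sq_nonneg _
  have hsq := convInProbZero_sum_sq hW hg hR
  have hZ := (convInProbZero_linear_part hW hg hR hmean).add (hsq.const_mul (-1 / 4))
  -- On `∑ W² ≤ σ + 1` the Taylor remainder `(η/2) ∑ W²` is then at most `ε/4`; the cap `1` serves
  -- the logarithm bound.
  set η := min 1 (ε / (2 * (σ + 1)))
  have hη : 0 < η := lt_min one_pos (by positivity)
  have hη1 : η ≤ 1 := min_le_left _ _
  have hη2 : η * (σ + 1) ≤ ε / 2 := by
    calc η * (σ + 1) ≤ ε / (2 * (σ + 1)) * (σ + 1) := by gcongr; exact min_le_right _ _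
      _ = ε / 2 := by field_simp
  have hlim := ((tendsto_measure_exists_le_abs hW hg hR hη).add (hsq 1 one_pos)).add
    (hZ (ε / 4) (by positivity))
  rw [add_zero, add_zero] at hlim
  refine tendsto_of_tendsto_of_tendsto_of_le_of_le tendsto_const_nhds hlim (fun _ => zero_le)
    fun n => (measure_mono ?_).trans ((measure_union_le _ _).trans
      (add_le_add (measure_union_le _ _) le_rfl))
  intro x hx
  by_contra hc
  simp only [Set.mem_union, Set.mem_ofPred_eq, not_or, not_exists, not_le] at hc
  obtain ⟨⟨h1, h2⟩, h3⟩ := hc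
  have hpos : ∀ i, 0 < 1 + W n (x i) / 2 := fun i => by
    have := neg_abs_le (W n (x i))
    linarith [h1 i]
  -- Off the exceptional events every `|W| < 1`, so the value `-∞` does not occur and the estimate
  -- is one between real numbers.
  have hlog : ENNReal.log (∏ i, ENNReal.ofReal ((1 + W n (x i) / 2) ^ 2)) =
      ((∑ i, 2 * Real.log (1 + W n (x i) / 2) : ℝ) : EReal) := by
    rw [← ENNReal.ofReal_prod_of_nonneg fun i _ => sq_nonneg _,
      ENNReal.log_ofReal_of_pos (Finset.prod_pos fun i _ => pow_pos (hpos i) 2),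
      Real.log_prod fun i _ => (pow_pos (hpos i) 2).ne']
    simp_rw [Real.log_pow]
    norm_cast
  simp only [Set.mem_ofPred_eq] at hx
  rw [hlog, ← EReal.coe_sub, EReal.abs_def,
    ENNReal.ofReal_le_ofReal_iff (abs_nonneg _)] at hx
  have h4 : |∑ i, (2 * Real.log (1 + W n (x i) / 2) - W n (x i) + W n (x i) ^ 2 / 4)| ≤
      η / 2 * ∑ i, W n (x i) ^ 2 := by
    rw [Finset.mul_sum]
    exact (Finset.abs_sum_le_sum_abs _ _).trans
      (Finset.sum_le_sum fun i _ => abs_two_mul_log_sub_le hη1 (h1 i))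
  have h5 : ∑ i, W n (x i) ^ 2 ≤ σ + 1 := by linarith [(abs_lt.1 h2).2]
  have h6 : η / 2 * ∑ i, W n (x i) ^ 2 ≤ ε / 4 := by nlinarith
  simp only [Finset.sum_add_distrib, Finset.sum_sub_distrib, ← Finset.sum_div] at h4
  have h7 := abs_lt.1 h3
  have h8 := abs_le.1 (h4.trans h6)
  have : |∑ i, 2 * Real.log (1 + W n (x i) / 2) - ((√n)⁻¹ * ∑ i, g (x i) - 1 / 2 * σ)| < ε := by
    rw [abs_lt]
    constructor <;> linarith [h7.1, h7.2, h8.1, h8.2]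
  linarith

end QuadraticMean

/-! ### Densities and covariances under product measures. -/

section ProductDerivative

variable {X : Type*} [MeasurableSpace X] {ι : Type*} [Fintype ι]

/-- The product of measures with density is the measure with the product density. -/
lemma pi_withDensity (P : Measure X) [IsProbabilityMeasure P] {f : X → ENNReal}
    (hf : Measurable f) [SigmaFinite (P.withDensity f)] :
    (Measure.pi fun _ : ι => P.withDensity f) =
      (Measure.pi fun _ : ι => P).withDensity fun x => ∏ i, f (x i) := by
  refine Measure.pi_eq fun s hs => ?_
  rw [withDensity_apply _ (MeasurableSet.univ_pi hs),
    ← lintegral_indicator (MeasurableSet.univ_pi hs)]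
  have e : (Set.univ.pi s).indicator (fun x : ι → X => ∏ i, f (x i)) =
      fun x => ∏ i, (s i).indicator f (x i) := by
    classical
    ext x
    by_cases hx : x ∈ Set.univ.pi s
    · rw [Set.indicator_of_mem hx]
      exact Finset.prod_congr rfl fun i _ => (Set.indicator_of_mem (hx i trivial) f).symm
    · rw [Set.indicator_of_notMem hx]
      simp only [Set.mem_univ_pi, not_forall] at hx
      obtain ⟨i, hi⟩ := hx
      exact (Finset.prod_eq_zero (Finset.mem_univ i) (Set.indicator_of_notMem hi f)).symm
  rw [e, lintegral_prod_eq_prod_lintegral_of_indepFun Finset.univ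
    (fun i (x : ι → X) => (s i).indicator f (x i))
    (iIndepFun_pi (μ := fun _ : ι => P) fun i => (hf.indicator (hs i)).aemeasurable)
    fun i => (hf.indicator (hs i)).comp (measurable_pi_apply i)]
  refine Finset.prod_congr rfl fun i _ => ?_
  rw [withDensity_apply _ (hs i), ← lintegral_indicator (hs i)]
  exact (measurePreserving_eval (fun _ : ι => P) i).lintegral_comp (hf.indicator (hs i))

/-- The Radon-Nikodym derivative of the absolutely continuous part of a product measure. -/
lemma rnDeriv_pi (P Q : Measure X) [IsProbabilityMeasure P] [IsFiniteMeasure Q] {A : Set X}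
    (hA : MeasurableSet A) (hPA : ∀ᵐ x ∂P, x ∈ A) {f : X → ENNReal} (hf : Measurable f)
    (hQ : Q.restrict A = P.withDensity f) :
    (Measure.pi fun _ : ι => Q).rnDeriv (Measure.pi fun _ : ι => P)
      =ᵐ[Measure.pi fun _ : ι => P] fun x => ∏ i, f (x i) := by
  have hB : MeasurableSet (Set.univ.pi fun _ : ι => A) := MeasurableSet.univ_pi fun _ => hA
  have hPB : (Measure.pi fun _ : ι => P) (Set.univ.pi fun _ : ι => A)ᶜ = 0 := by
    rw [← mem_ae_iff]
    filter_upwards [Measure.ae_pi_le_pi (eventually_pi (fun i => hPA))] with x hx i _ using hx i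
  -- Uniqueness of the Lebesgue decomposition: off `A^ι` the product of `Q` lives on a null set, and
  -- on `A^ι` it has the product density.
  have hsing : (Measure.pi fun _ : ι => Q).restrict (Set.univ.pi fun _ : ι => A)ᶜ ⟂ₘ
      Measure.pi fun _ : ι => P :=
    ⟨_, hB, by rw [Measure.restrict_apply hB, Set.inter_compl_self, measure_empty], hPB⟩
  have : SigmaFinite (P.withDensity f) := by rw [← hQ]; infer_instance
  refine (Measure.eq_rnDeriv
    (f := fun x : ι → X => ∏ i, f (x i))
    (Finset.univ.measurable_prod fun i _ => hf.comp (measurable_pi_apply i)) hsing ?_).symm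
  rw [← pi_withDensity P hf, ← hQ, ← Measure.restrict_pi_pi, Measure.restrict_compl_add_restrict hB]

/-- The covariance of two sums of functions of iid observations. -/
lemma covariance_sum_pi {P : Measure X} [IsProbabilityMeasure P] {f g : X → ℝ} (hf : MemLp f 2 P)
    (hg : MemLp g 2 P) :
    cov[fun x : ι → X => ∑ i, f (x i), fun x => ∑ i, g (x i); Measure.pi fun _ : ι => P] =
      Fintype.card ι * cov[f, g; P] := by
  have hf' (i : ι) : MemLp (fun x : ι → X => f (x i)) 2 (Measure.pi fun _ : ι => P) :=
    hf.comp_measurePreserving (measurePreserving_eval (fun _ : ι => P) i)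
  have hg' (i : ι) : MemLp (fun x : ι → X => g (x i)) 2 (Measure.pi fun _ : ι => P) :=
    hg.comp_measurePreserving (measurePreserving_eval (fun _ : ι => P) i)
  rw [covariance_fun_sum_fun_sum hf' hg']
  have h (i : ι) : ∑ j, cov[fun x : ι → X => f (x i), fun x => g (x j);
      Measure.pi fun _ : ι => P] = cov[f, g; P] := by
    rw [Finset.sum_eq_single i _ (by simp)]
    · rw [← covariance_map_fun (Z := fun x : ι → X => x i)]
      · rw [(measurePreserving_eval (fun _ : ι => P) i).map_eq]
      · rw [(measurePreserving_eval (fun _ : ι => P) i).map_eq]; exact hf.aestronglyMeasurable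
      · rw [(measurePreserving_eval (fun _ : ι => P) i).map_eq]; exact hg.aestronglyMeasurable
      · exact (measurable_pi_apply i).aemeasurable
    · intro j _ hji
      have hind := (iIndepFun_pi (μ := fun _ : ι => P) (X := fun _ x => x)
        fun _ => aemeasurable_id).indepFun hji.symm
      refine IndepFun.covariance_eq_zero (hind.comp₀ (φ := f) (ψ := g)
        (measurable_pi_apply i).aemeasurable (measurable_pi_apply j).aemeasurable
        ?_ ?_) (hf' i) (hg' j)
      · rw [(measurePreserving_eval (fun _ : ι => P) i).map_eq]
        exact hf.aestronglyMeasurable.aemeasurable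
      · rw [(measurePreserving_eval (fun _ : ι => P) j).map_eq]
        exact hg.aestronglyMeasurable.aemeasurable
  have h' := Finset.sum_congr (s₁ := Finset.univ) rfl fun i (_ : i ∈ Finset.univ) => h i
  simp only [Finset.sum_const, Finset.card_univ, nsmul_eq_mul] at h'
  exact h'

end ProductDerivative

/-! ### Root densities and the change of measure from `μ` to `f μ`. -/

section RootDensity

variable {X : Type*} [MeasurableSpace X] {μ : Measure X} {f q : X → ℝ}

lemma integral_withDensity_ofReal (hf : Measurable f) (hf0 : ∀ x, 0 ≤ f x) (F : X → ℝ) :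
    ∫ x, F x ∂(μ.withDensity fun x => ENNReal.ofReal (f x)) = ∫ x, f x * F x ∂μ := by
  rw [integral_withDensity_eq_integral_toReal_smul hf.ennreal_ofReal
    (Eventually.of_forall fun _ => ENNReal.ofReal_lt_top)]
  simp_rw [ENNReal.toReal_ofReal (hf0 _), smul_eq_mul]

/-- Multiplication by `√f` preserves the `L²` norm from `f μ` to `μ`. -/
lemma memLp_two_withDensity_ofReal {E : Type*} [NormedAddCommGroup E] [NormedSpace ℝ E]
    (hf : Measurable f) (hf0 : ∀ x, 0 ≤ f x) {F : X → E} (hF : AEStronglyMeasurable F μ)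
    (h : MemLp (fun x => √(f x) • F x) 2 μ) :
    MemLp F 2 (μ.withDensity fun x => ENNReal.ofReal (f x)) := by
  rw [memLp_two_iff_integrable_sq_norm (hF.mono_ac (withDensity_absolutelyContinuous _ _)),
    integrable_withDensity_iff_integrable_smul' hf.ennreal_ofReal
      (Eventually.of_forall fun _ => ENNReal.ofReal_lt_top)]
  refine ((memLp_two_iff_integrable_sq_norm h.1).1 h).congr (Eventually.of_forall fun x => ?_)
  simp only [norm_smul, mul_pow, Real.norm_eq_abs, sq_abs, Real.sq_sqrt (hf0 x),
    ENNReal.toReal_ofReal (hf0 x), smul_eq_mul]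

lemma integrable_of_lintegral_ofReal_eq_one (hq : Measurable q) (hq0 : ∀ x, 0 ≤ q x)
    (hq1 : ∫⁻ x, ENNReal.ofReal (q x) ∂μ = 1) : Integrable q μ :=
  (lintegral_ofReal_ne_top_iff_integrable hq.aestronglyMeasurable
    (Eventually.of_forall hq0)).1 (by simp [hq1])

lemma integral_eq_one_of_lintegral (hq : Measurable q) (hq0 : ∀ x, 0 ≤ q x)
    (hq1 : ∫⁻ x, ENNReal.ofReal (q x) ∂μ = 1) : ∫ x, q x ∂μ = 1 := by
  rw [integral_eq_lintegral_of_nonneg_ae (Eventually.of_forall hq0) hq.aestronglyMeasurable, hq1,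
    ENNReal.toReal_one]

lemma memLp_sqrt (hq : Measurable q) (hq0 : ∀ x, 0 ≤ q x) (hqi : Integrable q μ) :
    MemLp (fun x => √(q x)) 2 μ := by
  rw [memLp_two_iff_integrable_sq hq.sqrt.aestronglyMeasurable]
  simpa only [Real.sq_sqrt (hq0 _)] using hqi

/-- Twice the relative increment `√q / √f - 1` of the root density. -/
noncomputable def rootRatio {Y : Type*} (f q : Y → ℝ) (x : Y) : ℝ :=
  2 * (√(q x) / √(f x) - 1)

lemma measurable_rootRatio (hf : Measurable f) (hq : Measurable q) :
    Measurable (rootRatio f q) :=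
  ((hq.sqrt.div hf.sqrt).sub_const 1).const_mul 2

/-- Where `f = 0`, division by zero gives `rootRatio` the junk value `-2`; the factor `√f` removes
it. -/
lemma sqrt_mul_rootRatio {Y : Type*} {f q : Y → ℝ} (x : Y) :
    √(f x) * rootRatio f q x =
      {x | 0 < f x}.indicator (fun x => 2 * (√(q x) - √(f x))) x := by
  unfold rootRatio
  by_cases hx : 0 < f x
  · rw [Set.indicator_of_mem (show x ∈ {x | 0 < f x} from hx)]
    have := (Real.sqrt_pos.2 hx).ne'
    field_simp
  · rw [Set.indicator_of_notMem (show x ∉ {x | 0 < f x} from hx), Real.sqrt_eq_zero_of_nonpos (not_lt.1 hx), zero_mul]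

lemma memLp_rootRatio (hf : Measurable f) (hf0 : ∀ x, 0 ≤ f x) (hfi : Integrable f μ)
    (hq : Measurable q) (hq0 : ∀ x, 0 ≤ q x) (hqi : Integrable q μ) :
    MemLp (rootRatio f q) 2 (μ.withDensity fun x => ENNReal.ofReal (f x)) := by
  refine memLp_two_withDensity_ofReal hf hf0 (measurable_rootRatio hf hq).aestronglyMeasurable ?_
  simp_rw [smul_eq_mul, sqrt_mul_rootRatio]
  exact (((memLp_sqrt hq hq0 hqi).sub (memLp_sqrt hf hf0 hfi)).const_mul 2).indicator
    (measurableSet_lt measurable_const hf)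

/-- Pointwise `f W = (q - f) - (√q - √f)²`, also where `f = 0`, and `q`, `f` have equal mass. The
Hellinger integral thus includes the mass of `q` off `{f > 0}`. -/
lemma integral_rootRatio (hf : Measurable f) (hf0 : ∀ x, 0 ≤ f x)
    (hf1 : ∫⁻ x, ENNReal.ofReal (f x) ∂μ = 1) (hq : Measurable q) (hq0 : ∀ x, 0 ≤ q x)
    (hq1 : ∫⁻ x, ENNReal.ofReal (q x) ∂μ = 1) :
    ∫ x, rootRatio f q x ∂(μ.withDensity fun x => ENNReal.ofReal (f x)) =
      -∫ x, (√(q x) - √(f x)) ^ 2 ∂μ := by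
  have hfi := integrable_of_lintegral_ofReal_eq_one hf hf0 hf1
  have hqi := integrable_of_lintegral_ofReal_eq_one hq hq0 hq1
  have hd := ((memLp_sqrt hq hq0 hqi).sub (memLp_sqrt hf hf0 hfi)).integrable_sq
  simp only [Pi.sub_apply] at hd
  rw [integral_withDensity_ofReal hf hf0]
  have e : ∀ x, f x * rootRatio f q x = (q x - f x) - (√(q x) - √(f x)) ^ 2 := by
    intro x
    have h1 := Real.sq_sqrt (hf0 x)
    have h2 := Real.sq_sqrt (hq0 x)
    unfold rootRatio
    rcases (hf0 x).eq_or_lt with h | h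
    · rw [← h]; simp [h2]
    · have := (Real.sqrt_pos.2 h).ne'
      nth_rw 1 [← h1]
      field_simp
      nlinarith
  simp_rw [e]
  rw [integral_sub (f := fun x => q x - f x) (hqi.sub hfi) hd, integral_sub hqi hfi, integral_eq_one_of_lintegral hf hf0 hf1,
    integral_eq_one_of_lintegral hq hq0 hq1]
  ring

/-- The integrands agree on `{f > 0}`, the `4` being the square of the `2` in `rootRatio`; only the
contribution of `{f = 0}` is lost. -/
lemma integral_sq_rootRatio_sub_le (hf : Measurable f) (hf0 : ∀ x, 0 ≤ f x) (hfi : Integrable f μ)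
    (hq : Measurable q) (hq0 : ∀ x, 0 ≤ q x) (hqi : Integrable q μ) {h : X → ℝ} (hh : MemLp h 2 μ)
    (c : ℝ) :
    ∫ x, (c * rootRatio f q x - 2 * ((√(f x))⁻¹ * h x)) ^ 2
        ∂(μ.withDensity fun x => ENNReal.ofReal (f x)) ≤
      4 * ∫ x, (c * (√(q x) - √(f x)) - h x) ^ 2 ∂μ := by
  have hi : Integrable (fun x => (c * (√(q x) - √(f x)) - h x) ^ 2) μ :=
    ((((memLp_sqrt hq hq0 hqi).sub (memLp_sqrt hf hf0 hfi)).const_mul c).sub hh).integrable_sq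
  rw [integral_withDensity_ofReal hf hf0, ← integral_const_mul]
  refine integral_mono_of_nonneg (Eventually.of_forall fun x => mul_nonneg (hf0 x) (sq_nonneg _))
    (hi.const_mul 4) (Eventually.of_forall fun x => ?_)
  simp only
  rcases (hf0 x).eq_or_lt with h0 | h0
  · rw [← h0, zero_mul]; positivity
  · have h1 := (Real.sqrt_pos.2 h0).ne'
    refine le_of_eq ?_
    unfold rootRatio
    nth_rw 1 [← Real.sq_sqrt (hf0 x)]
    rw [← mul_pow, show (4 : ℝ) = 2 ^ 2 by norm_num, ← mul_pow]
    congr 1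
    field_simp

/-- On `{f > 0}`, the law with density `q` has density `(1 + rootRatio / 2)² = q / f` with respect
to the law with density `f`. -/
lemma restrict_withDensity_eq (hf : Measurable f) (hf0 : ∀ x, 0 ≤ f x) (hq : Measurable q)
    (hq0 : ∀ x, 0 ≤ q x) :
    (μ.withDensity fun x => ENNReal.ofReal (q x)).restrict {x | 0 < f x} =
      (μ.withDensity fun x => ENNReal.ofReal (f x)).withDensity
        fun x => ENNReal.ofReal ((1 + rootRatio f q x / 2) ^ 2) := by
  have hA : MeasurableSet {x | 0 < f x} := measurableSet_lt measurable_const hf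
  rw [restrict_withDensity hA, ← withDensity_indicator hA,
    ← withDensity_mul _ hf.ennreal_ofReal
      ((((measurable_rootRatio hf hq).div_const 2).const_add 1).pow_const 2).ennreal_ofReal]
  congr 1
  ext x
  rw [Pi.mul_apply, ← ENNReal.ofReal_mul (hf0 x)]
  by_cases hx : 0 < f x
  · rw [Set.indicator_of_mem (show x ∈ {x | 0 < f x} from hx)]
    congr 1
    have h1 := (Real.sqrt_pos.2 hx).ne'
    have h2 := Real.sq_sqrt (hf0 x)
    have h3 := Real.sq_sqrt (hq0 x)
    unfold rootRatio
    rw [show 1 + 2 * (√(q x) / √(f x) - 1) / 2 = √(q x) / √(f x) by ring, div_pow, h2, h3]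
    field_simp
  · rw [Set.indicator_of_notMem (show x ∉ {x | 0 < f x} from hx), le_antisymm (not_lt.1 hx) (hf0 x), zero_mul,
      ENNReal.ofReal_zero]

end RootDensity

/-! ### Local parameters and their increments. -/

section LocalParameters

variable {d : ℕ} {Ξ : Set ℝ} {Θ : Set (EuclideanSpace ℝ (Fin d))} {ξ₀ : ℝ}
  {ϑ : EuclideanSpace ℝ (Fin d)}

/-- The local parameter `(ξ₀ + δ₁ n^{-1/4}, ϑ + δ₂ n^{-1/2})`. -/
noncomputable def localParam (ξ₀ : ℝ) (ϑ : EuclideanSpace ℝ (Fin d)) (δ₁ : ℝ)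
    (δ₂ : EuclideanSpace ℝ (Fin d)) (n : ℕ) : ℝ × EuclideanSpace ℝ (Fin d) :=
  (ξ₀ + δ₁ * (n : ℝ) ^ (-(1 / 4) : ℝ), ϑ + ((n : ℝ) ^ (-(1 / 2) : ℝ)) • δ₂)

lemma tendsto_localParam (δ₁ : ℝ) (δ₂ : EuclideanSpace ℝ (Fin d)) :
    Tendsto (localParam ξ₀ ϑ δ₁ δ₂) atTop (𝓝 (ξ₀, ϑ)) := by
  have h1 := (tendsto_rpow_neg_atTop (show (0 : ℝ) < 1 / 4 by norm_num)).comp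
    tendsto_natCast_atTop_atTop
  have h2 := (tendsto_rpow_neg_atTop (show (0 : ℝ) < 1 / 2 by norm_num)).comp
    tendsto_natCast_atTop_atTop
  have h3 := (h1.const_mul δ₁).const_add ξ₀
  have h4 := (h2.smul_const δ₂).const_add ϑ
  rw [mul_zero, add_zero] at h3
  rw [zero_smul, add_zero] at h4
  exact h3.prodMk_nhds h4

lemma rpow_neg_half_eq (n : ℕ) : (n : ℝ) ^ (-(1 / 2) : ℝ) = (√n)⁻¹ := by
  rw [Real.rpow_neg (Nat.cast_nonneg n), ← Real.sqrt_eq_rpow]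

lemma increment_localParam (δ₁ : ℝ) (δ₂ : EuclideanSpace ℝ (Fin d)) (n : ℕ) :
    increment ξ₀ ϑ (localParam ξ₀ ϑ δ₁ δ₂ n) = (√(n : ℝ))⁻¹ • stack (δ₁ ^ 2) δ₂ := by
  have h : ((n : ℝ) ^ (-(1 / 4) : ℝ)) ^ 2 = (√(n : ℝ))⁻¹ := by
    rw [← rpow_neg_half_eq, ← Real.rpow_natCast, ← Real.rpow_mul (Nat.cast_nonneg n)]
    norm_num
  ext i
  rcases i with _ | i
  · change (ξ₀ + δ₁ * (n : ℝ) ^ (-(1 / 4) : ℝ) - ξ₀) ^ 2 = (√(n : ℝ))⁻¹ * δ₁ ^ 2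
    rw [add_sub_cancel_left, mul_pow, h, mul_comm]
  · simp [increment, localParam, stack, ← rpow_neg_half_eq]

lemma eventually_localParam_mem (hξ : ξ₀ ∈ interior Ξ) (hϑ : ϑ ∈ interior Θ) (δ₁ : ℝ)
    (δ₂ : EuclideanSpace ℝ (Fin d)) :
    ∀ᶠ n in atTop, localParam ξ₀ ϑ δ₁ δ₂ n ∈ Ξ ×ˢ Θ :=
  (tendsto_localParam δ₁ δ₂).eventually
    (prod_mem_nhds (mem_interior_iff_mem_nhds.1 hξ) (mem_interior_iff_mem_nhds.1 hϑ))

end LocalParameters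

/-! ### The score of one observation. -/

section UnitScore

variable {X : Type*} {d : ℕ} {p : ℝ → EuclideanSpace ℝ (Fin d) → X → ℝ} {ξ₀ : ℝ}
  {ϑ : EuclideanSpace ℝ (Fin d)}

/-- The score `v / √p` of a single observation. -/
noncomputable def unitScore (p : ℝ → EuclideanSpace ℝ (Fin d) → X → ℝ)
    (ξ₀ : ℝ) (ϑ : EuclideanSpace ℝ (Fin d)) (x : X) : EuclideanSpace ℝ (Unit ⊕ Fin d) :=
  (√(p ξ₀ ϑ x))⁻¹ • scoreVec p ξ₀ ϑ x

lemma scoreVec_eq_zero {x : X} (hx : p ξ₀ ϑ x ≤ 0) : scoreVec p ξ₀ ϑ x = 0 :=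
  Set.indicator_of_notMem (show x ∉ {x | 0 < p ξ₀ ϑ x} from not_lt.2 hx) _

lemma sqrt_smul_unitScore (x : X) :
    √(p ξ₀ ϑ x) • unitScore p ξ₀ ϑ x = scoreVec p ξ₀ ϑ x := by
  by_cases hx : 0 < p ξ₀ ϑ x
  · exact smul_inv_smul₀ (Real.sqrt_pos.2 hx).ne' _
  · rw [unitScore, scoreVec_eq_zero (not_lt.1 hx), smul_zero, smul_zero]

end UnitScore

/-! ### Verification for the density family. -/

section Experiment

variable {X : Type*} [MeasurableSpace X] {d : ℕ} {μ : Measure X}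
  {p : ℝ → EuclideanSpace ℝ (Fin d) → X → ℝ} {Ξ : Set ℝ} {Θ : Set (EuclideanSpace ℝ (Fin d))}
  {ξ₀ : ℝ} {ϑ : EuclideanSpace ℝ (Fin d)}

lemma IsDensityFamily.isProbabilityMeasure_law (hp : IsDensityFamily μ p Ξ Θ) {ξ : ℝ}
    (hξ : ξ ∈ Ξ) {θ : EuclideanSpace ℝ (Fin d)} (hθ : θ ∈ Θ) :
    IsProbabilityMeasure (law μ p ξ θ) :=
  ⟨by rw [law, withDensity_apply _ MeasurableSet.univ, Measure.restrict_univ,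
    hp.lintegral_eq_one ξ hξ θ hθ]⟩

lemma IsDensityFamily.integrable (hp : IsDensityFamily μ p Ξ Θ) {ξ : ℝ}
    (hξ : ξ ∈ Ξ) {θ : EuclideanSpace ℝ (Fin d)} (hθ : θ ∈ Θ) : Integrable (p ξ θ) μ :=
  integrable_of_lintegral_ofReal_eq_one (hp.measurable ξ hξ θ hθ) (hp.nonneg ξ hξ θ hθ)
    (hp.lintegral_eq_one ξ hξ θ hθ)

/-- Modified differentiability in quadratic mean along the local parameters. -/
lemma ModifiedDQM.tendsto_integral {v : X → EuclideanSpace ℝ (Unit ⊕ Fin d)}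
    (h : ModifiedDQM μ p Ξ Θ ξ₀ ϑ v) (hξ : ξ₀ ∈ interior Ξ) (hϑ : ϑ ∈ interior Θ) (δ₁ : ℝ)
    (δ₂ : EuclideanSpace ℝ (Fin d)) :
    Tendsto (fun n : ℕ => ∫ x, (√n * (√(p (localParam ξ₀ ϑ δ₁ δ₂ n).1
      (localParam ξ₀ ϑ δ₁ δ₂ n).2 x) - √(p ξ₀ ϑ x)) - inner ℝ (stack (δ₁ ^ 2) δ₂) (v x)) ^ 2 ∂μ)
      atTop (𝓝 0) := by
  have hq : Tendsto (localParam ξ₀ ϑ δ₁ δ₂) atTop (𝓝[Ξ ×ˢ Θ] (ξ₀, ϑ)) :=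
    tendsto_nhdsWithin_iff.2 ⟨tendsto_localParam δ₁ δ₂, eventually_localParam_mem hξ hϑ δ₁ δ₂⟩
  have h1 := h.expansion.comp_tendsto hq
  have h2 : ((fun q : ℝ × EuclideanSpace ℝ (Fin d) => ‖increment ξ₀ ϑ q‖ ^ 2) ∘
      localParam ξ₀ ϑ δ₁ δ₂) =O[atTop] fun n : ℕ => (n : ℝ)⁻¹ := by
    refine IsBigO.of_bound (‖stack (δ₁ ^ 2) δ₂‖ ^ 2) (Eventually.of_forall fun n => ?_)
    rw [Function.comp_apply, increment_localParam, norm_smul, mul_pow, norm_inv, inv_pow]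
    simp only [Real.norm_eq_abs, sq_abs, abs_mul, abs_inv, Nat.abs_cast, abs_pow, abs_norm,
      Real.sq_sqrt (Nat.cast_nonneg n)]
    rw [mul_comm]
  refine (h1.trans_isBigO h2).tendsto_div_nhds_zero.congr' ?_
  filter_upwards [eventually_gt_atTop 0] with n hn
  have hn' : (0 : ℝ) < n := by exact_mod_cast hn
  rw [div_inv_eq_mul, mul_comm, Function.comp_apply, ← integral_const_mul]
  congr with x
  have h0 := (Real.sqrt_pos.2 hn').ne'
  rw [increment_localParam, sq_abs, real_inner_smul_left]
  nth_rw 1 [← Real.sq_sqrt hn'.le]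
  rw [← mul_pow]
  congr 1
  field_simp

section Null

variable (hp : IsDensityFamily μ p Ξ Θ) (hξ : ξ₀ ∈ interior Ξ) (hϑ : ϑ ∈ interior Θ)
  (hv : MemLp (scoreVec p ξ₀ ϑ) 2 μ) (hD : ModifiedDQM μ p Ξ Θ ξ₀ ϑ (scoreVec p ξ₀ ϑ))

include hp hξ hϑ

include hv in
lemma memLp_unitScore : MemLp (unitScore p ξ₀ ϑ) 2 (law μ p ξ₀ ϑ) := by
  have hm := hp.measurable ξ₀ (interior_subset hξ) ϑ (interior_subset hϑ)
  refine memLp_two_withDensity_ofReal hm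
    (hp.nonneg ξ₀ (interior_subset hξ) ϑ (interior_subset hϑ))
    (hm.sqrt.inv.aestronglyMeasurable.smul hv.1) ?_
  simp_rw [sqrt_smul_unitScore]
  exact hv

lemma integral_unitScore_mul (i j : Unit ⊕ Fin d) :
    ∫ x, unitScore p ξ₀ ϑ x i * unitScore p ξ₀ ϑ x j ∂(law μ p ξ₀ ϑ) =
      ∫ x, scoreVec p ξ₀ ϑ x i * scoreVec p ξ₀ ϑ x j ∂μ := by
  have h0 := hp.nonneg ξ₀ (interior_subset hξ) ϑ (interior_subset hϑ)
  rw [law, integral_withDensity_ofReal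
    (hp.measurable ξ₀ (interior_subset hξ) ϑ (interior_subset hϑ)) h0]
  congr with x
  have h := sqrt_smul_unitScore (p := p) (ξ₀ := ξ₀) (ϑ := ϑ) x
  rw [← h]
  nth_rw 1 [← Real.sq_sqrt (h0 x)]
  simp only [PiLp.smul_apply, smul_eq_mul]
  ring

include hD in
-- These are the inputs of the product expansion. The last limit holds because `n E W = -∫ (√n(√q -
-- √f))² dμ` and `L²` convergence passes to the squares.
lemma tendsto_integral_rootRatio (δ₁ : ℝ) (δ₂ : EuclideanSpace ℝ (Fin d)) :
    (∀ᶠ n in atTop, MemLp (rootRatio (p ξ₀ ϑ) (p (localParam ξ₀ ϑ δ₁ δ₂ n).1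
      (localParam ξ₀ ϑ δ₁ δ₂ n).2)) 2 (law μ p ξ₀ ϑ)) ∧
    Tendsto (fun n : ℕ => ∫ x, (√n * rootRatio (p ξ₀ ϑ) (p (localParam ξ₀ ϑ δ₁ δ₂ n).1
      (localParam ξ₀ ϑ δ₁ δ₂ n).2) x -
        2 * inner ℝ (stack (δ₁ ^ 2) δ₂) (unitScore p ξ₀ ϑ x)) ^ 2 ∂(law μ p ξ₀ ϑ))
      atTop (𝓝 0) ∧
    Tendsto (fun n : ℕ => n * ∫ x, rootRatio (p ξ₀ ϑ) (p (localParam ξ₀ ϑ δ₁ δ₂ n).1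
      (localParam ξ₀ ϑ δ₁ δ₂ n).2) x ∂(law μ p ξ₀ ϑ)) atTop
      (𝓝 (-(∫ x, (2 * inner ℝ (stack (δ₁ ^ 2) δ₂) (unitScore p ξ₀ ϑ x)) ^ 2
        ∂(law μ p ξ₀ ϑ)) / 4)) := by
  have hξ' := interior_subset hξ
  have hϑ' := interior_subset hϑ
  have hm := hp.measurable ξ₀ hξ' ϑ hϑ'
  have h0 := hp.nonneg ξ₀ hξ' ϑ hϑ'
  have hi := hp.integrable hξ' hϑ'
  have hmem := eventually_localParam_mem (ξ₀ := ξ₀) (ϑ := ϑ) hξ hϑ δ₁ δ₂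
  have hh : MemLp (fun x => inner ℝ (stack (δ₁ ^ 2) δ₂) (scoreVec p ξ₀ ϑ x)) 2 μ :=
    hD.memLp.const_inner _
  have hlim := hD.tendsto_integral hξ hϑ δ₁ δ₂
  refine ⟨?_, ?_, ?_⟩
  · filter_upwards [hmem] with n hn
    exact memLp_rootRatio hm h0 hi (hp.measurable _ hn.1 _ hn.2) (hp.nonneg _ hn.1 _ hn.2)
      (hp.integrable hn.1 hn.2)
  · have h4 := hlim.const_mul 4
    rw [mul_zero] at h4
    refine squeeze_zero' (Eventually.of_forall fun _ => integral_nonneg fun _ => sq_nonneg _) ?_ h4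
    filter_upwards [hmem] with n hn
    have := integral_sq_rootRatio_sub_le hm h0 hi (hp.measurable _ hn.1 _ hn.2)
      (hp.nonneg _ hn.1 _ hn.2) (hp.integrable hn.1 hn.2) hh √n
    simpa only [unitScore, real_inner_smul_right, law] using this
  · have hsq := tendsto_integral_abs_sq_sub_sq (a := fun n : ℕ => fun x =>
      √n * (√(p (localParam ξ₀ ϑ δ₁ δ₂ n).1 (localParam ξ₀ ϑ δ₁ δ₂ n).2 x) - √(p ξ₀ ϑ x))) (by
        filter_upwards [hmem] with n hn
        exact ((memLp_sqrt (hp.measurable _ hn.1 _ hn.2) (hp.nonneg _ hn.1 _ hn.2)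
          (hp.integrable hn.1 hn.2)).sub (memLp_sqrt hm h0 hi)).const_mul _) hh hlim
    have e : ∫ x, (2 * inner ℝ (stack (δ₁ ^ 2) δ₂) (unitScore p ξ₀ ϑ x)) ^ 2 ∂(law μ p ξ₀ ϑ) =
        4 * ∫ x, inner ℝ (stack (δ₁ ^ 2) δ₂) (scoreVec p ξ₀ ϑ x) ^ 2 ∂μ := by
      rw [law, integral_withDensity_ofReal hm h0, ← integral_const_mul]
      congr with x
      rw [← sqrt_smul_unitScore x, real_inner_smul_right, mul_pow √(p ξ₀ ϑ x),
        Real.sq_sqrt (h0 x)]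
      ring
    rw [e, neg_div, mul_div_cancel_left₀ _ (by norm_num : (4 : ℝ) ≠ 0)]
    have key : Tendsto (fun n : ℕ => ∫ x, (√n * (√(p (localParam ξ₀ ϑ δ₁ δ₂ n).1
        (localParam ξ₀ ϑ δ₁ δ₂ n).2 x) - √(p ξ₀ ϑ x))) ^ 2 ∂μ) atTop
        (𝓝 (∫ x, inner ℝ (stack (δ₁ ^ 2) δ₂) (scoreVec p ξ₀ ϑ x) ^ 2 ∂μ)) := by
      rw [tendsto_iff_dist_tendsto_zero]
      refine squeeze_zero' (Eventually.of_forall fun _ => dist_nonneg) ?_ hsq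
      filter_upwards [hmem] with n hn
      have hn2 := (((memLp_sqrt (hp.measurable _ hn.1 _ hn.2) (hp.nonneg _ hn.1 _ hn.2)
          (hp.integrable hn.1 hn.2)).sub (memLp_sqrt hm h0 hi)).const_mul √n).integrable_sq
      simp only [Pi.sub_apply] at hn2
      rw [Real.dist_eq, ← integral_sub hn2 hh.integrable_sq]
      exact abs_integral_le_integral_abs
    refine key.neg.congr' ?_
    filter_upwards [hmem] with n hn
    rw [law, integral_rootRatio hm h0 (hp.lintegral_eq_one ξ₀ hξ' ϑ hϑ')
      (hp.measurable _ hn.1 _ hn.2) (hp.nonneg _ hn.1 _ hn.2) (hp.lintegral_eq_one _ hn.1 _ hn.2)]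
    simp_rw [mul_pow, Real.sq_sqrt (Nat.cast_nonneg n), integral_const_mul]
    ring

include hD in
lemma integral_inner_unitScore (δ₁ : ℝ) (δ₂ : EuclideanSpace ℝ (Fin d)) :
    ∫ x, inner ℝ (stack (δ₁ ^ 2) δ₂) (unitScore p ξ₀ ϑ x) ∂(law μ p ξ₀ ϑ) = 0 := by
  have := hp.isProbabilityMeasure_law (interior_subset hξ) (interior_subset hϑ)
  obtain ⟨h1, h2, h3⟩ := tendsto_integral_rootRatio hp hξ hϑ hD δ₁ δ₂
  have h := integral_eq_zero_of_tendsto h1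
    (((memLp_unitScore hp hξ hϑ hD.memLp).const_inner (stack (δ₁ ^ 2) δ₂)).const_mul 2) h2 h3
  rw [integral_const_mul] at h
  linarith

include hD in
/-- The score has mean zero under the null distribution. -/
lemma integral_unitScore_apply (i : Unit ⊕ Fin d) :
    ∫ x, unitScore p ξ₀ ϑ x i ∂(law μ p ξ₀ ϑ) = 0 := by
  -- The first entry of `t` is a square, but `δ₁ = 1`, and `δ₁ = 0` with unit vectors `δ₂`, already
  -- reach every coordinate.
  rcases i with _ | i
  · have h := integral_inner_unitScore hp hξ hϑ hD 1 0
    simpa [stack, PiLp.inner_apply] using h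
  · have h := integral_inner_unitScore hp hξ hϑ hD 0 (EuclideanSpace.single i 1)
    simpa [stack, PiLp.inner_apply, PiLp.single_apply, Pi.single_apply] using h

include hD in
-- The `n` equal covariances cancel the `1/n` in `(2/√n)²`, and centring turns the one-observation
-- covariance into a second moment.
lemma covariance_scoreSum {n : ℕ} (hn : 1 ≤ n) (i j : Unit ⊕ Fin d) :
    cov[fun x => scoreSum p ξ₀ ϑ n x i, fun x => scoreSum p ξ₀ ϑ n x j; jointLaw μ p n ξ₀ ϑ] =
      infoMatrix μ p ξ₀ ϑ i j := by
  have := hp.isProbabilityMeasure_law (interior_subset hξ) (interior_subset hϑ)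
  have hu := memLp_unitScore hp hξ hϑ hD.memLp
  have hn' : (0 : ℝ) < n := by exact_mod_cast hn
  have e (i : Unit ⊕ Fin d) : (fun x : Fin n → X => scoreSum p ξ₀ ϑ n x i) =
      fun x => 2 / √(n : ℝ) * ∑ k, unitScore p ξ₀ ϑ (x k) i := by
    ext x; simp [scoreSum, unitScore]
  rw [e i, e j, covariance_const_mul_left, covariance_const_mul_right, jointLaw,
    covariance_sum_pi (f := fun x => unitScore p ξ₀ ϑ x i) (g := fun x => unitScore p ξ₀ ϑ x j)
      (hu.eval_piLp i) (hu.eval_piLp j), covariance_eq_sub (hu.eval_piLp i) (hu.eval_piLp j),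
    integral_unitScore_apply hp hξ hϑ hD]
  simp only [Pi.mul_apply, Fintype.card_fin, infoMatrix, Matrix.of_apply]
  rw [integral_unitScore_mul hp hξ hϑ]
  have h1 := (Real.sqrt_pos.2 hn').ne'
  have h2 := Real.sq_sqrt hn'.le
  field_simp
  rw [h2]
  ring

include hv in
lemma memLp_scoreSum (n : ℕ) : MemLp (scoreSum p ξ₀ ϑ n) 2 (jointLaw μ p n ξ₀ ϑ) := by
  have := hp.isProbabilityMeasure_law (interior_subset hξ) (interior_subset hϑ)
  exact (memLp_sum_pi (memLp_unitScore hp hξ hϑ hv) n).const_smul (2 / √(n : ℝ))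

include hD in
lemma integral_scoreSum_mul {n : ℕ} (hn : 1 ≤ n) (i j : Unit ⊕ Fin d) :
    ∫ x, scoreSum p ξ₀ ϑ n x i * scoreSum p ξ₀ ϑ n x j ∂(jointLaw μ p n ξ₀ ϑ) =
      infoMatrix μ p ξ₀ ϑ i j := by
  have := hp.isProbabilityMeasure_law (interior_subset hξ) (interior_subset hϑ)
  have : IsProbabilityMeasure (jointLaw μ p n ξ₀ ϑ) := by unfold jointLaw; infer_instance
  have hS := memLp_scoreSum hp hξ hϑ hD.memLp n
  have hmean : ∫ x, scoreSum p ξ₀ ϑ n x i ∂(jointLaw μ p n ξ₀ ϑ) = 0 := by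
    have e : (fun x : Fin n → X => scoreSum p ξ₀ ϑ n x i) =
        fun x => 2 / √(n : ℝ) * ∑ k, unitScore p ξ₀ ϑ (x k) i := by
      ext x; simp [scoreSum, unitScore]
    rw [e, integral_const_mul, jointLaw, integral_sum_pi (f := fun x => unitScore p ξ₀ ϑ x i)
      (((memLp_unitScore hp hξ hϑ hD.memLp).eval_piLp i).integrable one_le_two),
      integral_unitScore_apply hp hξ hϑ hD, mul_zero, mul_zero]
  have h := covariance_eq_sub (hS.eval_piLp i) (hS.eval_piLp j)
  rw [covariance_scoreSum hp hξ hϑ hD hn, hmean, zero_mul, sub_zero] at h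
  exact h.symm

include hv in
lemma dotProduct_infoMatrix_mulVec (t : EuclideanSpace ℝ (Unit ⊕ Fin d)) :
    t.ofLp ⬝ᵥ (infoMatrix μ p ξ₀ ϑ *ᵥ t.ofLp) =
      ∫ x, (2 * inner ℝ t (unitScore p ξ₀ ϑ x)) ^ 2 ∂(law μ p ξ₀ ϑ) := by
  have hu := memLp_unitScore hp hξ hϑ hv
  have e : ∀ x, (2 * inner ℝ t (unitScore p ξ₀ ϑ x)) ^ 2 =
      ∑ i, ∑ j, t i * (4 * (unitScore p ξ₀ ϑ x i * unitScore p ξ₀ ϑ x j) * t j) := by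
    intro x
    rw [mul_pow, sq (inner ℝ _ _), PiLp.inner_apply, Finset.sum_mul_sum, Finset.mul_sum]
    refine Finset.sum_congr rfl fun i _ => ?_
    rw [Finset.mul_sum]
    refine Finset.sum_congr rfl fun j _ => ?_
    simp only [RCLike.inner_apply, conj_trivial]
    ring
  have hint (i j : Unit ⊕ Fin d) : Integrable (fun x =>
      t i * (4 * (unitScore p ξ₀ ϑ x i * unitScore p ξ₀ ϑ x j) * t j)) (law μ p ξ₀ ϑ) :=
    ((((hu.eval_piLp i).integrable_mul (hu.eval_piLp j)).const_mul 4).mul_const _).const_mul _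
  simp_rw [e]
  rw [integral_finsetSum _ fun i _ => integrable_finsetSum _ fun j _ => hint i j]
  simp only [dotProduct, mulVec, Finset.mul_sum]
  refine Finset.sum_congr rfl fun i _ => ?_
  rw [integral_finsetSum _ fun j _ => hint i j]
  refine Finset.sum_congr rfl fun j _ => ?_
  rw [integral_const_mul, integral_mul_const, integral_const_mul,
    integral_unitScore_mul hp hξ hϑ, infoMatrix, Matrix.of_apply]

/-- The set `{f > 0}` has full null measure and carries the density `(1 + W/2)²`, so the product
derivative formula applies with it. -/
lemma logLR_ae_eq (δ₁ : ℝ) (δ₂ : EuclideanSpace ℝ (Fin d)) {n : ℕ}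
    (hn : localParam ξ₀ ϑ δ₁ δ₂ n ∈ Ξ ×ˢ Θ) :
    logLR μ p ξ₀ ϑ δ₁ δ₂ n =ᵐ[jointLaw μ p n ξ₀ ϑ] fun x =>
      ENNReal.log (∏ i, ENNReal.ofReal ((1 + rootRatio (p ξ₀ ϑ) (p (localParam ξ₀ ϑ δ₁ δ₂ n).1
        (localParam ξ₀ ϑ δ₁ δ₂ n).2) (x i) / 2) ^ 2)) := by
  have hξ' := interior_subset hξ
  have hϑ' := interior_subset hϑ
  have hm := hp.measurable ξ₀ hξ' ϑ hϑ'
  have hmn := hp.measurable _ hn.1 _ hn.2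
  have := hp.isProbabilityMeasure_law hξ' hϑ'
  have := hp.isProbabilityMeasure_law hn.1 hn.2
  have hA : MeasurableSet {x | 0 < p ξ₀ ϑ x} := measurableSet_lt measurable_const hm
  have hPA : ∀ᵐ x ∂(law μ p ξ₀ ϑ), x ∈ {x | 0 < p ξ₀ ϑ x} := by
    rw [law, ae_withDensity_iff hm.ennreal_ofReal]
    refine Eventually.of_forall fun x hx => ?_
    simpa using hx
  have h := rnDeriv_pi (ι := Fin n) (law μ p ξ₀ ϑ)
    (law μ p (localParam ξ₀ ϑ δ₁ δ₂ n).1 (localParam ξ₀ ϑ δ₁ δ₂ n).2) hA hPA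
    ((((measurable_rootRatio hm hmn).div_const 2).const_add 1).pow_const 2).ennreal_ofReal
    (restrict_withDensity_eq hm (hp.nonneg ξ₀ hξ' ϑ hϑ') hmn (hp.nonneg _ hn.1 _ hn.2))
  filter_upwards [h] with x hx
  rw [← hx]
  rfl

end Null

end Experiment

end ModifiedLAN

theorem theorem3p3 {X : Type*} [MeasurableSpace X] {d : ℕ} (μ : Measure X)
    (p : ℝ → EuclideanSpace ℝ (Fin d) → X → ℝ) (Ξ : Set ℝ)
    (Θ : Set (EuclideanSpace ℝ (Fin d))) (ξ₀ : ℝ) (ϑ : EuclideanSpace ℝ (Fin d))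
    (hp : ModifiedLAN.IsDensityFamily μ p Ξ Θ) (hϑ : ϑ ∈ interior Θ)
    (hA : ModifiedLAN.DensityAssumption μ p Ξ Θ ξ₀ ϑ)
    (hDQM : ModifiedLAN.ModifiedDQM μ p Ξ Θ ξ₀ ϑ (ModifiedLAN.scoreVec p ξ₀ ϑ)) :
    -- `Λ_n = tᵀ S_n - ½ tᵀ J t + o_P(1)` under the null, with `t = (δ₁², δ₂ᵀ)ᵀ`
    (∀ (δ₁ : ℝ) (δ₂ : EuclideanSpace ℝ (Fin d)) (ε : ℝ), 0 < ε →
      Tendsto (fun n : ℕ =>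
        ModifiedLAN.jointLaw μ p n ξ₀ ϑ
          {x | ENNReal.ofReal ε ≤
            (ModifiedLAN.logLR μ p ξ₀ ϑ δ₁ δ₂ n x -
              ((inner ℝ (ModifiedLAN.stack (δ₁ ^ 2) δ₂) (ModifiedLAN.scoreSum p ξ₀ ϑ n x) -
                1 / 2 * ((ModifiedLAN.stack (δ₁ ^ 2) δ₂).ofLp ⬝ᵥ
                  (ModifiedLAN.infoMatrix μ p ξ₀ ϑ *ᵥ
                    (ModifiedLAN.stack (δ₁ ^ 2) δ₂).ofLp)) : ℝ) : EReal)).abs})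
        atTop (𝓝 0)) ∧
    -- `J` is the matrix of second moments and covariances of `S_n` under the null
    (∀ n : ℕ, 1 ≤ n →
      MemLp (ModifiedLAN.scoreSum p ξ₀ ϑ n) 2 (ModifiedLAN.jointLaw μ p n ξ₀ ϑ) ∧
      ModifiedLAN.infoMatrix μ p ξ₀ ϑ =
        Matrix.fromBlocks
          (Matrix.of fun _ _ => ∫ x, (ModifiedLAN.scoreSum p ξ₀ ϑ n x (Sum.inl ())) ^ 2
            ∂(ModifiedLAN.jointLaw μ p n ξ₀ ϑ))
          (Matrix.of fun _ k => cov[fun x => ModifiedLAN.scoreSum p ξ₀ ϑ n x (Sum.inl ()),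
            fun x => ModifiedLAN.scoreSum p ξ₀ ϑ n x (Sum.inr k);
            ModifiedLAN.jointLaw μ p n ξ₀ ϑ])
          (Matrix.of fun j _ => cov[fun x => ModifiedLAN.scoreSum p ξ₀ ϑ n x (Sum.inr j),
            fun x => ModifiedLAN.scoreSum p ξ₀ ϑ n x (Sum.inl ());
            ModifiedLAN.jointLaw μ p n ξ₀ ϑ])
          (Matrix.of fun j k => ∫ x, ModifiedLAN.scoreSum p ξ₀ ϑ n x (Sum.inr j) *
              ModifiedLAN.scoreSum p ξ₀ ϑ n x (Sum.inr k)
            ∂(ModifiedLAN.jointLaw μ p n ξ₀ ϑ))) := by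
  have hξ := hA.interior_mem
  have hP := hp.isProbabilityMeasure_law (interior_subset hξ) (interior_subset hϑ)
  refine ⟨fun δ₁ δ₂ ε hε => ?_, fun n hn =>
    ⟨ModifiedLAN.memLp_scoreSum hp hξ hϑ hDQM.memLp n, ?_⟩⟩
  · obtain ⟨h1, h2, h3⟩ := ModifiedLAN.tendsto_integral_rootRatio hp hξ hϑ hDQM δ₁ δ₂
    have h := ModifiedLAN.tendsto_measure_log_prod_sub_ge h1
      (((ModifiedLAN.memLp_unitScore hp hξ hϑ hDQM.memLp).const_inner
        (ModifiedLAN.stack (δ₁ ^ 2) δ₂)).const_mul 2) h2 h3 hε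
    -- Once the local parameter lies in `Ξ ×ˢ Θ`, the two events coincide almost surely.
    refine h.congr' ?_
    filter_upwards [ModifiedLAN.eventually_localParam_mem hξ hϑ δ₁ δ₂] with n hn
    refine measure_congr ?_
    filter_upwards [ModifiedLAN.logLR_ae_eq hp hξ hϑ δ₁ δ₂ hn] with x hx
    have e : (√(n : ℝ))⁻¹ * ∑ i, 2 * inner ℝ (ModifiedLAN.stack (δ₁ ^ 2) δ₂)
        (ModifiedLAN.unitScore p ξ₀ ϑ (x i)) =
        inner ℝ (ModifiedLAN.stack (δ₁ ^ 2) δ₂) (ModifiedLAN.scoreSum p ξ₀ ϑ n x) := by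
      rw [ModifiedLAN.scoreSum, real_inner_smul_right, inner_sum, ← Finset.mul_sum]
      simp only [ModifiedLAN.unitScore]
      ring
    refine propext ?_
    change ENNReal.ofReal ε ≤ _ ↔ ENNReal.ofReal ε ≤ _
    rw [hx, ModifiedLAN.dotProduct_infoMatrix_mulVec hp hξ hϑ hDQM.memLp, e]
  · ext i j
    rcases i with i | i <;> rcases j with j | j
    · simp_rw [Matrix.fromBlocks_apply₁₁, Matrix.of_apply, sq]
      exact (ModifiedLAN.integral_scoreSum_mul hp hξ hϑ hDQM hn _ _).symm
    · exact (ModifiedLAN.covariance_scoreSum hp hξ hϑ hDQM hn _ _).symm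
    · exact (ModifiedLAN.covariance_scoreSum hp hξ hϑ hDQM hn _ _).symm
    · exact (ModifiedLAN.integral_scoreSum_mul hp hξ hϑ hDQM hn _ _).symm
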